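/- **Setting.** Order $[0,\infty)^4$ coordinatewise. A function $F:[0,\infty)^4\to[0,\infty)$ is *strongly permissible* if it is nondecreasing and continuous, if $x\,l_y+y\,l_x\le F(x,y,l_x,l_y)$ for all $x,y,l_x,l_y\ge 0$, and if $\lambda\mu F(x,y,l_x,l_y)\le F(\lambda x,\mu y,\lambda l_x,\mu l_y)$ for all $x,y,l_x,l_y,\lambda,\mu\ge 0$. For a nonzero unital C*-algebra $\mathfrak A$, write $\mathfrak{sa}(\mathfrak A)$ for its self-adjoint part and $\mathscr S(\mathfrak A)$ for its state space. An *$F$-quasi-Leibniz quantum compact metric space* (briefly: an $F$-space) is a pair $(\mathfrak A,\mathsf L)$ of a nonzero unital C*-algebra $\mathfrak A$ and a seminorm $\mathsf L$ defined on a dense subspace $\mathrm{dom}(\mathsf L)$ of $\mathfrak{sa}(\mathfrak A)$ closed under the Jordan product $\frac12(ab+ba)$ and the Lie product $\frac1{2i}(ab-ba)$ (and extended to $\mathfrak{sa}(\mathfrak A)$ by the value $\infty$ outside $\mathrm{dom}(\mathsf L)$), such that 1. $\{a:\mathsf L(a)=0\}=\mathbb R 1_{\mathfrak A}$; 2. $\{a\in\mathfrak{sa}(\mathfrak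 A):\mathsf L(a)\le 1\}$ is norm closed; 3. the Monge–Kantorovich metric $\mathsf{mk}_{\mathsf L}(\varphi,\psi)=\sup\{|\varphi(a)-\psi(a)|:\mathsf L(a)\le1\}$ induces the weak* topology on $\mathscr S(\mathfrak A)$; 4. $\mathsf L\big(\tfrac12(ab+ba)\big)$ and $\mathsf L\big(\tfrac1{2i}(ab-ba)\big)$ are at most $F(\|a\|,\|b\|,\mathsf L(a),\mathsf L(b))$ for all $a,b\in\mathrm{dom}(\mathsf L)$. Let $\mathrm{diam}(\mathfrak A,\mathsf L)$ be the diameter of $\mathscr S(\mathfrak A)$ for $\mathsf{mk}_{\mathsf L}$. An *$F$-tunnel* from $(\mathfrak A_1,\mathsf L_1)$ to $(\mathfrak A_2,\mathsf L_2)$ consists of an $F$-space $(\mathfrak D,\mathsf L_{\mathfrak D})$ and surjective unital $*$-homomorphisms $\pi_j:\mathfrak D\to\mathfrak A_j$ such that $\mathsf L_j(a)=\inf\{\mathsf L_{\mathfrak D}(d):d\in\mathfrak{sa}(\mathfrak D),\ \pi_j(d)=a\}$ for all $a\in\mathfrak{sa}(\mathfrak A_j)$, $j=1,2$. Its *extent*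 is the larger, over $j=1,2$, of the Hausdorff distances, for $\mathsf{mk}_{\mathsf L_{\mathfrak D}}$, between $\mathscr S(\mathfrak D)$ and $\{\varphi\circ\pi_j:\varphi\in\mathscr S(\mathfrak A_j)\}$. The *dual propinquity* $\Lambda_F\big((\mathfrak A_1,\mathsf L_1),(\mathfrak A_2,\mathsf L_2)\big)$ is the infimum of the extents of all $F$-tunnels from $(\mathfrak A_1,\mathsf L_1)$ to $(\mathfrak A_2,\mathsf L_2)$. The *covering number* $\mathrm{Cov}_F(\mathfrak A,\mathsf L,\varepsilon)$ is the least $n\in\mathbb N$ for which there is an $F$-space $(\mathfrak B,\mathsf L_{\mathfrak B})$ with $\dim_{\mathbb C}\mathfrak B\le n$ and $\Lambda_F\big((\mathfrak A,\mathsf L),(\mathfrak B,\mathsf L_{\mathfrak B})\big)\le\varepsilon$, and $\infty$ if there is none. **Theorem.** Let $F$ be strongly permissible and let $\mathcal A$ be a class of $F$-spaces contained in the closure, for $\Lambda_F$, of the class of finite dimensional $F$-spaces (that is, for every $(\mathfrak A,\mathsf L)\in\mathcal A$ and $\varepsilon>0$ there is an $F$-space $(\mathfrak B,\mathsf L_{\mathfrak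 B})$ with $\dim_{\mathbb C}\mathfrak B<\infty$ and $\Lambda_F\big((\mathfrak A,\mathsf L),(\mathfrak B,\mathsf L_{\mathfrak B})\big)<\varepsilon$). The following are equivalent: 1. $\mathcal A$ is totally bounded for $\Lambda_F$: for every $\varepsilon>0$ there is a finite subset $\mathcal T$ of $\mathcal A$ such that every element of $\mathcal A$ is at $\Lambda_F$-distance less than $\varepsilon$ from some element of $\mathcal T$; 2. there are a function $f:(0,\infty)\to\mathbb N$ and $K>0$ such that, for all $(\mathfrak A,\mathsf L)\in\mathcal A$, $\mathrm{diam}(\mathfrak A,\mathsf L)\le K$ and $\mathrm{Cov}_F(\mathfrak A,\mathsf L,\varepsilon)\le f(\varepsilon)$ for all $\varepsilon>0$. -/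

import Mathlib

open scoped ENNReal NNReal ComplexOrder

universe u

noncomputable section

namespace QuantumMetric

/-! ### Permissible functions -/

/-- A permissible function `F : [0,∞)⁴ → [0,∞)`: it is nondecreasing for the coordinatewise order
and `x l_y + y l_x ≤ F(x, y, l_x, l_y)`. -/
structure Permissible (F : ℝ≥0 × ℝ≥0 × ℝ≥0 × ℝ≥0 → ℝ≥0) : Prop where
  monotone : Monotone F
  le_apply : ∀ x y lx ly : ℝ≥0, x * ly + y * lx ≤ F (x, y, lx, ly)

/-- A strongly permissible function: permissible, continuous, and
`λ μ F(x, y, l_x, l_y) ≤ F(λ x, μ y, λ l_x, μ l_y)`. -/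
structure StronglyPermissible (F : ℝ≥0 × ℝ≥0 × ℝ≥0 × ℝ≥0 → ℝ≥0) : Prop
    extends Permissible F where
  continuous : Continuous F
  mul_le : ∀ x y lx ly r s : ℝ≥0,
    r * s * F (x, y, lx, ly) ≤ F (r * x, s * y, r * lx, s * ly)

/-! ### The state space -/

section State

variable (A : Type u) [CStarAlgebra A]

/-- The state space of a unital C*-algebra: the continuous linear functionals `φ` with `φ 1 = 1`
and `0 ≤ φ (a* a)` for all `a`. As a subtype of `WeakDual ℂ A` it carries the weak* topology. -/
def StateSpace : Type u :=
  {φ : WeakDual ℂ A // φ 1 = 1 ∧ ∀ a : A, 0 ≤ φ (star a * a)}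

instance : TopologicalSpace (StateSpace A) :=
  inferInstanceAs (TopologicalSpace {φ : WeakDual ℂ A // φ 1 = 1 ∧ ∀ a : A, 0 ≤ φ (star a * a)})

instance : CoeFun (StateSpace A) (fun _ => A → ℂ) := ⟨fun φ a => φ.1 a⟩

variable {A}

/-- The dual map `π* : 𝒮(B) → 𝒮(A)`, `φ ↦ φ ∘ π`, of a unital *-homomorphism `π : A → B`. -/
def StateSpace.comap {B : Type u} [CStarAlgebra B] (π : A →⋆ₐ[ℂ] B) (φ : StateSpace B) :
    StateSpace A :=
  ⟨StrongDual.toWeakDual ((WeakDual.toStrongDual φ.1).comp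
      { toLinearMap := (π : A →ₐ[ℂ] B).toLinearMap
        cont := AddMonoidHomClass.continuous_of_bound π 1
          (by simpa only [one_mul] using NonUnitalStarAlgHom.norm_apply_le π) }),
    by
      refine ⟨?_, fun a => ?_⟩
      · change φ.1 (π 1) = 1
        rw [map_one]
        exact φ.2.1
      · change 0 ≤ φ.1 (π (star a * a))
        rw [map_mul, map_star]
        exact φ.2.2 (π a)⟩

theorem StateSpace.comap_apply {B : Type u} [CStarAlgebra B] (π : A →⋆ₐ[ℂ] B) (φ : StateSpace B)
    (a : A) : StateSpace.comap π φ a = φ (π a) := rfl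

/-- The Monge–Kantorovich metric of an extended-valued seminorm `L` on the self-adjoint part:
`mk_L(φ, ψ) = sup {|φ(a) - ψ(a)| : a ∈ sa(A), L(a) ≤ 1}`, with values in `[0,∞]`. -/
def mkDist (L : selfAdjoint A → ℝ≥0∞) (φ ψ : StateSpace A) : ℝ≥0∞ :=
  ⨆ (a : selfAdjoint A) (_ : L a ≤ 1), ‖φ (a : A) - ψ (a : A)‖ₑ

/-- The Monge–Kantorovich metric as an extended (pseudo)metric structure on the state space. -/
@[reducible] def mkPseudoEMetric (L : selfAdjoint A → ℝ≥0∞) : PseudoEMetricSpace (StateSpace A) where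
  edist := mkDist L
  edist_self φ := by simp [mkDist]
  edist_comm φ ψ := by
    unfold mkDist
    refine iSup_congr fun a => iSup_congr fun _ => ?_
    rw [← edist_eq_enorm_sub, ← edist_eq_enorm_sub, edist_comm]
  edist_triangle φ ψ χ := by
    refine iSup₂_le fun a ha => ?_
    rw [← edist_eq_enorm_sub]
    refine (edist_triangle _ (ψ (a : A)) _).trans ?_
    rw [edist_eq_enorm_sub, edist_eq_enorm_sub]
    exact add_le_add
      (le_iSup₂ (f := fun (a : selfAdjoint A) (_ : L a ≤ 1) => ‖φ (a : A) - ψ (a : A)‖ₑ) a ha)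
      (le_iSup₂ (f := fun (a : selfAdjoint A) (_ : L a ≤ 1) => ‖ψ (a : A) - χ (a : A)‖ₑ) a ha)

/-- The diameter of the state space for the Monge–Kantorovich metric. -/
def stateDiam (L : selfAdjoint A → ℝ≥0∞) : ℝ≥0∞ :=
  letI := mkPseudoEMetric L
  Metric.ediam (Set.univ : Set (StateSpace A))

/-- The Hausdorff distance, for the Monge–Kantorovich metric, between sets of states. -/
def stateHausdorff (L : selfAdjoint A → ℝ≥0∞) (S T : Set (StateSpace A)) : ℝ≥0∞ :=
  letI := mkPseudoEMetric L
  Metric.hausdorffEDist S T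

end State

/-! ### Quasi-Leibniz quantum compact metric spaces -/

section LipNorm

variable {A : Type u} [CStarAlgebra A]

/-- The Jordan product `(ab + ba)/2` of self-adjoint elements. -/
def jordan (a b : selfAdjoint A) : selfAdjoint A :=
  ⟨(1 / 2 : ℂ) • ((a : A) * b + b * a), by
    rw [selfAdjoint.mem_iff, star_smul, star_add, star_mul, star_mul, selfAdjoint.star_val_eq,
      selfAdjoint.star_val_eq, add_comm]
    simp⟩

/-- The Lie product `(ab - ba)/(2i)` of self-adjoint elements. -/
def lie (a b : selfAdjoint A) : selfAdjoint A :=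
  ⟨(1 / (2 * Complex.I) : ℂ) • ((a : A) * b - b * a), by
    rw [selfAdjoint.mem_iff, star_smul, star_sub, star_mul, star_mul, selfAdjoint.star_val_eq,
      selfAdjoint.star_val_eq, ← neg_sub, smul_neg, ← neg_smul]
    simp⟩

/-- `L` is an `F`-quasi-Leibniz Lip-norm on `A`.

The seminorm, which is defined on a dense Jordan–Lie subalgebra `dom L` of `sa(A)`, is extended to
`sa(A)` by the value `∞` outside of `dom L`, so that `dom L = {a | L a < ∞}`. By `jordan_le` and
`lie_le`, whose right hand sides are finite, `dom L` is closed under both products. -/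
structure IsQuasiLeibnizLipNorm (F : ℝ≥0 × ℝ≥0 × ℝ≥0 × ℝ≥0 → ℝ≥0)
    (L : selfAdjoint A → ℝ≥0∞) : Prop where
  add_le : ∀ a b, L (a + b) ≤ L a + L b
  smul_eq : ∀ (t : ℝ) (a), L (t • a) = ‖t‖ₑ * L a
  dense_dom : Dense {a | L a < ∞}
  eq_zero_iff : ∀ a, L a = 0 ↔ ∃ t : ℝ, a = t • (1 : selfAdjoint A)
  isClosed_unitBall : IsClosed {a | L a ≤ 1}
  /-- The Monge–Kantorovich metric induces the weak* topology on the state space. -/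
  mk_topology : (mkPseudoEMetric L).toUniformSpace.toTopologicalSpace =
    (inferInstance : TopologicalSpace (StateSpace A))
  jordan_le : ∀ a b, L a < ∞ → L b < ∞ →
    L (jordan a b) ≤ F (‖(a : A)‖₊, ‖(b : A)‖₊, (L a).toNNReal, (L b).toNNReal)
  lie_le : ∀ a b, L a < ∞ → L b < ∞ →
    L (lie a b) ≤ F (‖(a : A)‖₊, ‖(b : A)‖₊, (L a).toNNReal, (L b).toNNReal)

end LipNorm

/-- An `F`-quasi-Leibniz quantum compact metric space: a nonzero unital C*-algebra with an
`F`-quasi-Leibniz Lip-norm. -/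
structure QLQCMS (F : ℝ≥0 × ℝ≥0 × ℝ≥0 × ℝ≥0 → ℝ≥0) : Type (u + 1) where
  carrier : Type u
  [cstar : CStarAlgebra carrier]
  [nontrivial : Nontrivial carrier]
  lip : selfAdjoint carrier → ℝ≥0∞
  isLipNorm : IsQuasiLeibnizLipNorm F lip

namespace QLQCMS

variable {F : ℝ≥0 × ℝ≥0 × ℝ≥0 × ℝ≥0 → ℝ≥0}

instance : CoeSort (QLQCMS.{u} F) (Type u) := ⟨QLQCMS.carrier⟩

instance (A : QLQCMS.{u} F) : CStarAlgebra A := A.cstar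

instance (A : QLQCMS.{u} F) : Nontrivial A := A.nontrivial

/-- `diam(A, L)`: the diameter of the state space for the Monge–Kantorovich metric. -/
def diam (A : QLQCMS.{u} F) : ℝ≥0∞ := stateDiam A.lip

end QLQCMS

/-! ### Tunnels and the dual propinquity -/

section Propinquity

variable {F : ℝ≥0 × ℝ≥0 × ℝ≥0 × ℝ≥0 → ℝ≥0}

/-- The image of a self-adjoint element under a unital *-homomorphism. -/
def saMap {D A : Type u} [CStarAlgebra D] [CStarAlgebra A] (π : D →⋆ₐ[ℂ] A) (d : selfAdjoint D) :
    selfAdjoint A :=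
  ⟨π d, by rw [selfAdjoint.mem_iff, ← map_star, selfAdjoint.star_val_eq]⟩

/-- `L_A` is the quotient of `L_D` by `π`: `L_A(a) = inf {L_D(d) : d ∈ sa(D), π(d) = a}`. -/
def IsQuotientSeminorm {D A : Type u} [CStarAlgebra D] [CStarAlgebra A] (π : D →⋆ₐ[ℂ] A)
    (LD : selfAdjoint D → ℝ≥0∞) (LA : selfAdjoint A → ℝ≥0∞) : Prop :=
  ∀ a : selfAdjoint A, LA a = ⨅ (d : selfAdjoint D) (_ : saMap π d = a), LD d

/-- An `F`-tunnel `(D, L_D, π₁, π₂)` from `A₁` to `A₂`. -/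
structure Tunnel (A₁ A₂ : QLQCMS.{u} F) where
  space : QLQCMS.{u} F
  π₁ : space →⋆ₐ[ℂ] A₁
  π₂ : space →⋆ₐ[ℂ] A₂
  surjective₁ : Function.Surjective π₁
  surjective₂ : Function.Surjective π₂
  quotient₁ : IsQuotientSeminorm π₁ space.lip A₁.lip
  quotient₂ : IsQuotientSeminorm π₂ space.lip A₂.lip

/-- The extent of a tunnel: the larger of the two Hausdorff distances from `𝒮(D)` to
`π_j*(𝒮(A_j))`, `j = 1, 2`, for the Monge–Kantorovich metric of `L_D`. -/
def Tunnel.extent {A₁ A₂ : QLQCMS.{u} F} (τ : Tunnel A₁ A₂) : ℝ≥0∞ :=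
  max (stateHausdorff τ.space.lip Set.univ (Set.range (StateSpace.comap τ.π₁)))
    (stateHausdorff τ.space.lip Set.univ (Set.range (StateSpace.comap τ.π₂)))

/-- The dual propinquity `Λ_F`: the infimum of the extents of all `F`-tunnels. -/
def propinquity (A B : QLQCMS.{u} F) : ℝ≥0∞ := ⨅ τ : Tunnel A B, τ.extent

/-- The class of finite dimensional `F`-quasi-Leibniz quantum compact metric spaces. -/
def finiteDimensional (F : ℝ≥0 × ℝ≥0 × ℝ≥0 × ℝ≥0 → ℝ≥0) : Set (QLQCMS.{u} F) :=
  {B | FiniteDimensional ℂ B}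

/-- The closure of a class for the dual propinquity. -/
def propinquityClosure (S : Set (QLQCMS.{u} F)) : Set (QLQCMS.{u} F) :=
  {A | ∀ ε : ℝ≥0∞, 0 < ε → ∃ B ∈ S, propinquity A B < ε}

/-- A class is totally bounded for the dual propinquity if for every `ε > 0` it has a finite
`ε`-dense subset. -/
def PropinquityTotallyBounded (S : Set (QLQCMS.{u} F)) : Prop :=
  ∀ ε : ℝ≥0∞, 0 < ε → ∃ T ⊆ S, T.Finite ∧ ∀ A ∈ S, ∃ B ∈ T, propinquity A B < ε

/-- The covering number `Cov_F(A, L, ε)`: the least `n` for which there is an `F`-quasi-Leibniz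
quantum compact metric space `B` with `dim_ℂ B ≤ n` and `Λ_F(A, B) ≤ ε`; it is `∞` if there is no
such `n`. -/
def coveringNumber (A : QLQCMS.{u} F) (ε : ℝ) : ℕ∞ :=
  ⨅ (n : ℕ) (_ : ∃ B : QLQCMS.{u} F,
    Module.rank ℂ B ≤ (n : Cardinal.{u}) ∧ propinquity A B ≤ ENNReal.ofReal ε), (n : ℕ∞)

end Propinquity

end QuantumMetric

end

namespace QuantumMetric

/-! ### Positive functionals and states -/

section PositiveFunctional

variable {A : Type u} [CStarAlgebra A] {f : A →ₗ[ℂ] ℂ}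

/-! Total boundedness gives the bounds by transferring data from a finite net. A tunnel of extent
less than `r` changes diameters by at most `2r` (`diam_le_of_propinquity_lt`), and the dimensions of
finite dimensional approximants of the net points bound every covering number, by
`propinquity_triangle`.

For the converse, each space is replaced by an approximant of bounded dimension and diameter, so it
suffices to divide such approximants into finitely many classes of small propinquity diameter
(`exists_coloring`). By Wedderburn's theorem there are finitely many algebra types of bounded
dimension, and an algebra isomorphism between finite dimensional C*-algebras can be improved to a
*-isomorphism (`nonempty_starAlgEquiv_of_algEquiv`). So one may fix an algebra `E`. Modulo scalars,
a Lip-norm is determined by its unit ball in the compact ball of radius `K` of `E`; recording which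
points of a finite net that set comes near leaves finitely many possibilities, and two spaces with
the same record have close unit balls.

Both the triangle inequality and the comparison of unit balls rest on one construction,
`propinquity_le_of_glue`: on `D₁ × D₂` one takes the maximum of the two Lip-norms and a multiple of
`‖p d₁ - q d₂‖`. That this is again a Lip-norm uses Rieffel's criterion, proved here in both
directions: the metric gives the weak* topology exactly when the Lip unit ball is totally bounded
modulo scalars. -/

theorem map_star_of_nonneg (hf : ∀ a, 0 ≤ f (star a * a)) (a : A) :
    f (star a) = star (f a) := by
  have h0 := (Complex.nonneg_iff.1 (hf a)).2
  -- Positivity at `a + 1` makes `f a + f (star a)` real; at `a + i` it equates the real parts of `f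
  -- a` and `f (star a)`.
  have h1 := (Complex.nonneg_iff.1 (hf (a + 1))).2
  have h2 := (Complex.nonneg_iff.1 (hf (a + Complex.I • 1))).2
  have h3 := (Complex.nonneg_iff.1 (hf 1)).2
  simp only [star_add, star_smul, star_one, mul_add, add_mul, mul_one, one_mul, map_add,
    Complex.add_im, smul_mul_assoc, mul_smul_comm, map_smul, smul_eq_mul, Complex.star_def,
    Complex.conj_I, smul_add, Complex.mul_im, Complex.neg_im, Complex.neg_re, Complex.I_re,
    Complex.I_im] at h0 h1 h2 h3
  simp only [neg_mul, Complex.neg_re, Complex.I_mul_re] at h2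
  apply Complex.ext <;> simp <;> linarith

theorem im_eq_zero_of_nonneg (hf : ∀ a, 0 ≤ f (star a * a)) (a : selfAdjoint A) :
    (f a).im = 0 := by
  have := map_star_of_nonneg hf (a : A)
  rw [selfAdjoint.star_val_eq] at this
  exact Complex.conj_eq_iff_im.1 this.symm

theorem re_nonneg_of_nonneg (hf : ∀ a, 0 ≤ f (star a * a)) : 0 ≤ (f 1).re := by
  simpa using (Complex.nonneg_iff.1 (hf 1)).1

/-- Both `‖a‖ - a` and `‖a‖ + a` are of the form `star c * c`. -/
theorem norm_le_of_nonneg_of_isSelfAdjoint (hf : ∀ a, 0 ≤ f (star a * a)) (a : selfAdjoint A) :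
    ‖f a‖ ≤ ‖a‖ * (f 1).re := by
  let := CStarAlgebra.spectralOrder A
  let := CStarAlgebra.spectralOrderedRing A
  have key : ∀ b : selfAdjoint A, (f b).re ≤ ‖b‖ * (f 1).re := fun b => by
    have h1 : (b : A) ≤ algebraMap ℝ A ‖(b : A)‖ := IsSelfAdjoint.le_algebraMap_norm_self b.2
    obtain ⟨c, hc⟩ := CStarAlgebra.nonneg_iff_eq_star_mul_self.1 (sub_nonneg.2 h1)
    have h2 := (Complex.nonneg_iff.1 (hf c)).1
    rw [← hc, map_sub, Algebra.algebraMap_eq_smul_one, ← Complex.coe_smul, map_smul] at h2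
    simpa using h2
  have h1 := key a
  have h2 := key (-a)
  have h3 : f a = ((f a).re : ℂ) := Complex.ext rfl (by simpa using im_eq_zero_of_nonneg hf a)
  rw [h3, Complex.norm_real, Real.norm_eq_abs, abs_le]
  simp only [norm_neg, NegMemClass.coe_neg, map_neg, Complex.neg_re] at h2
  constructor <;> linarith

/-- The factor 2 from splitting into real and imaginary parts is not sharp, but continuity and weak*
compactness need only some bound. -/
theorem norm_le_of_nonneg (hf : ∀ a, 0 ≤ f (star a * a)) (a : A) :
    ‖f a‖ ≤ 2 * (f 1).re * ‖a‖ := by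
  have h1 := norm_le_of_nonneg_of_isSelfAdjoint hf (realPart a)
  have h2 := norm_le_of_nonneg_of_isSelfAdjoint hf (imaginaryPart a)
  have h3 := realPart.norm_le a
  have h4 := imaginaryPart.norm_le a
  have h5 := re_nonneg_of_nonneg hf
  have h6 : ‖f a‖ ≤ ‖f (realPart a)‖ + ‖f (imaginaryPart a)‖ := by
    conv_lhs => rw [← realPart_add_I_smul_imaginaryPart a, map_add, map_smul]
    refine (norm_add_le _ _).trans ?_
    rw [norm_smul, Complex.norm_I, one_mul]
  nlinarith

end PositiveFunctional

/-! ### States: compactness, convexity, norming, products -/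

namespace StateSpace

variable {A : Type u} [CStarAlgebra A]

/-- The state given by a positive linear functional `f` with `f 1 = 1`. -/
noncomputable def ofNonneg (f : A →ₗ[ℂ] ℂ) (h1 : f 1 = 1) (hf : ∀ a, 0 ≤ f (star a * a)) :
    StateSpace A :=
  ⟨StrongDual.toWeakDual (f.mkContinuous (2 * (f 1).re) (norm_le_of_nonneg hf)), h1, hf⟩

@[simp]
theorem ofNonneg_apply (f : A →ₗ[ℂ] ℂ) (h1 : f 1 = 1) (hf : ∀ a, 0 ≤ f (star a * a)) (a : A) :
    ofNonneg f h1 hf a = f a := rfl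

/-- The linear functional underlying a state. -/
noncomputable def toLinearMap (φ : StateSpace A) : A →ₗ[ℂ] ℂ :=
  (WeakDual.toStrongDual φ.1).toLinearMap

@[simp]
theorem toLinearMap_apply (φ : StateSpace A) (a : A) : φ.toLinearMap a = φ a := rfl

variable (φ ψ : StateSpace A)

theorem toLinearMap_nonneg (a : A) : 0 ≤ φ.toLinearMap (star a * a) := φ.2.2 a

@[simp] theorem apply_one : φ 1 = 1 := φ.2.1
@[simp] theorem apply_zero : φ 0 = 0 := φ.toLinearMap.map_zero
theorem apply_add (a b : A) : φ (a + b) = φ a + φ b := φ.toLinearMap.map_add a b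
theorem apply_sub (a b : A) : φ (a - b) = φ a - φ b := φ.toLinearMap.map_sub a b
theorem apply_smul (c : ℂ) (a : A) : φ (c • a) = c * φ a := φ.toLinearMap.map_smul c a
theorem apply_real_smul (c : ℝ) (a : A) : φ (c • a) = c * φ a := by
  rw [← Complex.coe_smul, apply_smul]

theorem norm_apply_le (a : selfAdjoint A) : ‖φ (a : A)‖ ≤ ‖a‖ := by
  simpa using norm_le_of_nonneg_of_isSelfAdjoint φ.toLinearMap_nonneg a

theorem norm_apply_le_two (a : A) : ‖φ a‖ ≤ 2 * ‖a‖ := by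
  simpa using norm_le_of_nonneg φ.toLinearMap_nonneg a

theorem coe_re_apply (a : selfAdjoint A) : ((φ (a : A)).re : ℂ) = φ (a : A) :=
  Complex.ext rfl (by simpa using (im_eq_zero_of_nonneg φ.toLinearMap_nonneg a).symm)

@[ext]
theorem ext {φ ψ : StateSpace A} (h : ∀ a, φ a = ψ a) : φ = ψ :=
  Subtype.ext (DFunLike.ext _ _ h)

theorem continuous_apply (a : A) : Continuous fun φ : StateSpace A => φ a :=
  (WeakDual.eval_continuous a).comp continuous_subtype_val

instance : CompactSpace (StateSpace A) := by
  refine isCompact_iff_compactSpace (s := {φ : WeakDual ℂ A | φ 1 = 1 ∧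
    ∀ a : A, 0 ≤ φ (star a * a)}).1 ?_
  refine (WeakDual.isCompact_closedBall (𝕜 := ℂ) (E := A) 0 2).of_isClosed_subset ?_ ?_
  · refine (isClosed_singleton.preimage (WeakDual.eval_continuous (𝕜 := ℂ) (1 : A))).inter ?_
    change IsClosed {φ : WeakDual ℂ A | ∀ a : A, 0 ≤ φ (star a * a)}
    rw [show {φ : WeakDual ℂ A | ∀ a : A, 0 ≤ φ (star a * a)} =
      ⋂ a : A, {φ : WeakDual ℂ A | 0 ≤ φ (star a * a)} by ext; simp]
    exact isClosed_iInter fun a => isClosed_Ici.preimage (WeakDual.eval_continuous _)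
  · intro φ hφ
    have : ‖WeakDual.toStrongDual φ‖ ≤ 2 :=
      ContinuousLinearMap.opNorm_le_bound _ zero_le_two
        (norm_apply_le_two (⟨φ, hφ⟩ : StateSpace A))
    simpa using this

/-- The convex combination `t φ + (1 - t) ψ` of states. -/
noncomputable def mix (t : ℝ) (ht : t ∈ Set.Icc (0 : ℝ) 1) (φ ψ : StateSpace A) : StateSpace A :=
  ofNonneg ((t : ℂ) • φ.toLinearMap + ((1 - t : ℝ) : ℂ) • ψ.toLinearMap)
    (by simp) fun a => by
      have h1 : (0 : ℂ) ≤ (t : ℂ) := by exact_mod_cast ht.1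
      have h2 : (0 : ℂ) ≤ ((1 - t : ℝ) : ℂ) := by exact_mod_cast sub_nonneg.2 ht.2
      exact add_nonneg (mul_nonneg h1 (φ.2.2 a)) (mul_nonneg h2 (ψ.2.2 a))

theorem mix_apply (t : ℝ) (ht : t ∈ Set.Icc (0 : ℝ) 1) (a : A) :
    mix t ht φ ψ a = t * φ a + (1 - t : ℝ) * ψ a := rfl

/-- A norm one functional with value `1` at `1` is positive. -/
theorem nonneg_of_norm_le_one {g : A →ₗ[ℂ] ℂ} (hg : ∀ a, ‖g a‖ ≤ ‖a‖) (h1 : g 1 = 1) (a : A) :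
    0 ≤ g (star a * a) := by
  let := CStarAlgebra.spectralOrder A
  let := CStarAlgebra.spectralOrderedRing A
  rcases subsingleton_or_nontrivial A with hA | hA
  · rw [Subsingleton.elim (star a * a) 0, map_zero]
  set x := star a * a with hx
  have hxsa : IsSelfAdjoint x := IsSelfAdjoint.star_mul_self a
  have hx0 : 0 ≤ x := star_mul_self_nonneg a
  rw [Complex.nonneg_iff]
  constructor
  -- Since `0 ≤ x ≤ ‖x‖`, the value `‖x‖ - g x` has modulus at most `‖x‖`, which forces `Re (g x) ≥
  -- 0`.
  · have h2 : ‖algebraMap ℝ A ‖x‖ - x‖ ≤ ‖x‖ := by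
      refine (CStarAlgebra.norm_le_norm_of_nonneg_of_le
        (sub_nonneg.2 hxsa.le_algebraMap_norm_self) (sub_le_self _ hx0)).trans ?_
      simp
    have h3 := (Complex.abs_re_le_norm _).trans ((hg _).trans h2)
    rw [map_sub, Algebra.algebraMap_eq_smul_one, ← Complex.coe_smul, map_smul, h1] at h3
    have := (abs_le.1 h3).2
    simp at this
    exact this
  · by_contra hne
    have key : ∀ t : ℝ, ((g x).im + t) ^ 2 ≤ ‖x‖ ^ 2 + t ^ 2 := fun t => by
      have e1 : ‖x + ((t : ℂ) * Complex.I) • (1 : A)‖ ^ 2 ≤ ‖x‖ ^ 2 + t ^ 2 := by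
        rw [sq, ← CStarRing.norm_star_mul_self]
        have : star (x + ((t : ℂ) * Complex.I) • (1 : A)) * (x + ((t : ℂ) * Complex.I) • (1 : A))
            = star x * x + ((t ^ 2 : ℝ) : ℂ) • 1 := by
          simp only [star_add, star_smul, star_one, hxsa.star_eq, mul_add, add_mul, smul_mul_assoc,
            mul_smul_comm, one_mul, mul_one]
          simp only [Complex.star_def, map_mul, Complex.conj_ofReal, Complex.conj_I]
          match_scalars <;> simp
          · rw [mul_mul_mul_comm, Complex.I_mul_I]; ring
        rw [this]
        refine (norm_add_le _ _).trans ?_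
        rw [CStarRing.norm_star_mul_self, norm_smul, norm_one, mul_one, Complex.norm_real,
          Real.norm_of_nonneg (sq_nonneg t), ← sq]
      have e2 := Complex.abs_im_le_norm (g (x + ((t : ℂ) * Complex.I) • (1 : A)))
      have e3 := e2.trans (hg _)
      have e4 : (g (x + ((t : ℂ) * Complex.I) • (1 : A))).im = (g x).im + t := by
        rw [map_add, map_smul, h1]; simp
      rw [e4] at e3
      calc _ = |(g x).im + t| ^ 2 := (sq_abs _).symm
        _ ≤ _ := (pow_le_pow_left₀ (abs_nonneg _) e3 2).trans e1
    -- This `t` makes the cross term `2 t Im (g x)` equal to `2‖x‖² + 2`, too large for `key`.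
    have := key ((‖x‖ ^ 2 + 1) / (g x).im)
    have h4 : (g x).im * ((‖x‖ ^ 2 + 1) / (g x).im) = ‖x‖ ^ 2 + 1 := by
      field_simp [show (g x).im ≠ 0 from fun h => hne h.symm]
    nlinarith [sq_nonneg (g x).im, sq_nonneg ‖x‖]

/-- The spectral radius of `a` is its norm, so for a sign `e` the element `‖a‖ + e a` has norm
`2‖a‖`. For `a ≠ 0`, a Hahn–Banach functional `g` norming it must satisfy `g 1 = 1` and `|g a| =
‖a‖`, and such a `g` is a state. -/
theorem exists_norm_apply_eq [Nontrivial A] (a : selfAdjoint A) :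
    ∃ φ : StateSpace A, ‖φ (a : A)‖ = ‖a‖ := by
  obtain ⟨e, he, hn⟩ : ∃ e : ℝ, |e| = 1 ∧
      2 * ‖a‖ ≤ ‖((‖a‖ : ℝ) : ℂ) • (1 : A) + (e : ℂ) • (a : A)‖ := by
    obtain ⟨z, hz, hza⟩ := spectrum.exists_nnnorm_eq_spectralRadius (a : A)
    rw [IsSelfAdjoint.spectralRadius_eq_nnnorm a.2] at hza
    have hza' : ‖z‖ = ‖a‖ := congrArg NNReal.toReal (ENNReal.coe_inj.1 hza)
    have hzr : z = z.re := IsSelfAdjoint.mem_spectrum_eq_re a.2 hz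
    have key : ∀ e : ℝ, (e : ℂ) ≠ 0 → ‖(‖a‖ : ℂ) + e * z‖ ≤
        ‖((‖a‖ : ℝ) : ℂ) • (1 : A) + (e : ℂ) • (a : A)‖ := fun e he => by
      apply spectrum.norm_le_norm_of_mem
      rw [← Algebra.algebraMap_eq_smul_one, add_comm (‖a‖ : ℂ), spectrum.add_mem_add_iff]
      have h := (spectrum.smul_mem_smul_iff (r := Units.mk0 (e : ℂ) he)).2 hz
      simpa [Units.smul_def, add_comm] using h
    rw [hzr] at hza' key
    rw [Complex.norm_real, Real.norm_eq_abs] at hza'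
    rcases abs_cases z.re with ⟨h, h'⟩ | ⟨h, h'⟩
    · refine ⟨1, by simp, le_trans ?_ (key 1 (by simp))⟩
      rw [← hza', h, ← Complex.ofReal_mul, ← Complex.ofReal_add, Complex.norm_real,
        Real.norm_of_nonneg (by linarith)]
      linarith
    · refine ⟨-1, by simp, le_trans ?_ (key (-1) (by simp))⟩
      rw [← hza', h, ← Complex.ofReal_mul, ← Complex.ofReal_add, Complex.norm_real,
        Real.norm_of_nonneg (by linarith)]
      linarith
  by_cases ha : ‖a‖ = 0
  · have : Nonempty (StateSpace A) := by
      obtain ⟨g, hg, hg1⟩ := exists_dual_vector ℂ (1 : A) (by simp)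
      exact ⟨ofNonneg g.toLinearMap (by simpa using hg1)
        (nonneg_of_norm_le_one (fun a => by simpa [hg] using g.le_opNorm a) (by simpa using hg1))⟩
    obtain ⟨φ⟩ := this
    exact ⟨φ, le_antisymm (φ.norm_apply_le a) (by rw [ha]; exact norm_nonneg _)⟩
  have hpos : 0 < ‖a‖ := lt_of_le_of_ne (norm_nonneg _) (Ne.symm ha)
  obtain ⟨g, hg, hgb⟩ := exists_dual_vector ℂ
    (((‖a‖ : ℝ) : ℂ) • (1 : A) + (e : ℂ) • (a : A)) (by linarith)
  have hle : ∀ x, ‖g x‖ ≤ ‖x‖ := fun x => by simpa [hg] using g.le_opNorm x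
  rw [map_add, map_smul, map_smul] at hgb
  have h1 : ‖g 1‖ ≤ 1 := by simpa using hle 1
  have h2 : ‖g a‖ ≤ ‖a‖ := hle a
  have h4 : ‖(e : ℂ) • g a‖ ≤ ‖a‖ := by simpa [norm_smul, he] using h2
  have hre := congrArg Complex.re hgb
  simp only [Complex.add_re, smul_eq_mul, Complex.re_ofReal_mul] at hre
  simp only [Complex.coe_algebraMap, Complex.ofReal_re] at hre
  have h5 := (Complex.re_le_norm ((e : ℂ) • g a)).trans h4
  rw [smul_eq_mul, Complex.re_ofReal_mul] at h5
  have h6 : 1 ≤ (g 1).re := by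
    have : ‖a‖ * 1 ≤ ‖a‖ * (g 1).re := by
      have : (((‖((‖a‖ : ℝ) : ℂ) • (1 : A) + (e : ℂ) • (a : A)‖ : ℝ) : ℂ)).re =
        ‖((‖a‖ : ℝ) : ℂ) • (1 : A) + (e : ℂ) • (a : A)‖ := Complex.ofReal_re _
      linarith
    exact le_of_mul_le_mul_left this hpos
  have h7 : g 1 = 1 := by
    have hsq := Complex.sq_norm (g 1)
    rw [Complex.normSq_apply] at hsq
    have : ‖g 1‖ ^ 2 ≤ 1 := pow_le_one₀ (norm_nonneg _) h1
    have him : (g 1).im = 0 := by nlinarith [sq_nonneg (g 1).im]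
    have hre1 : (g 1).re ≤ 1 := (Complex.re_le_norm _).trans h1
    exact Complex.ext (by simpa using le_antisymm hre1 h6) (by simpa using him)
  refine ⟨ofNonneg g.toLinearMap h7 (nonneg_of_norm_le_one hle h7), le_antisymm h2 ?_⟩
  change ‖a‖ ≤ ‖g a‖
  rw [h7] at hgb
  have h8 : (e : ℂ) * g a = ((‖((‖a‖ : ℝ) : ℂ) • (1 : A) + (e : ℂ) • (a : A)‖ : ℝ) : ℂ) - ‖a‖ := by
    rw [← smul_eq_mul]; refine (eq_sub_of_add_eq' ?_); simpa using hgb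
  have h9 : ‖(e : ℂ) * g a‖ = ‖g a‖ := by simp [he]
  rw [← h9, h8, ← Complex.ofReal_sub, Complex.norm_real, Real.norm_eq_abs]
  exact le_trans (by linarith) (le_abs_self _)

instance [Nontrivial A] : Nonempty (StateSpace A) :=
  ⟨(exists_norm_apply_eq (0 : selfAdjoint A)).choose⟩

theorem norm_le_of_forall_state [Nontrivial A] (a : selfAdjoint A) {r : ℝ}
    (h : ∀ φ : StateSpace A, ‖φ (a : A)‖ ≤ r) : ‖a‖ ≤ r := by
  obtain ⟨φ, hφ⟩ := exists_norm_apply_eq a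
  exact hφ ▸ h φ

theorem exists_eq_mul_of_nonneg [Nontrivial A] {f : A →ₗ[ℂ] ℂ} (hf : ∀ a, 0 ≤ f (star a * a)) :
    ∃ χ : StateSpace A, ∀ a, f a = (f 1).re * χ a := by
  have h1 : f 1 = ((f 1).re : ℂ) :=
    Complex.ext rfl (by simpa using im_eq_zero_of_nonneg hf 1)
  by_cases h0 : (f 1).re = 0
  · obtain ⟨χ⟩ := (inferInstance : Nonempty (StateSpace A))
    refine ⟨χ, fun a => ?_⟩
    have := norm_le_of_nonneg hf a
    rw [h0, mul_zero, zero_mul, norm_le_zero_iff] at this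
    rw [this, h0, Complex.ofReal_zero, zero_mul]
  · have h0' : ((f 1).re : ℂ) ≠ 0 := by exact_mod_cast h0
    refine ⟨ofNonneg (((f 1).re : ℂ)⁻¹ • f) ?_ fun a => ?_, fun a => ?_⟩
    · rw [LinearMap.smul_apply, h1]; simp [h0']
    · have : (0 : ℂ) ≤ ((f 1).re : ℂ)⁻¹ := by
        rw [← Complex.ofReal_inv]
        exact_mod_cast inv_nonneg.2 (re_nonneg_of_nonneg hf)
      exact mul_nonneg this (hf a)
    · simp [h0']

/-- Every state of a product is a convex combination of states of the factors. -/
theorem exists_prod_decomposition {B : Type u} [CStarAlgebra B] [Nontrivial A] [Nontrivial B]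
    (φ : StateSpace (A × B)) :
    ∃ (t : ℝ) (_ : t ∈ Set.Icc (0 : ℝ) 1) (φ₁ : StateSpace A) (φ₂ : StateSpace B),
      ∀ d, φ d = t * φ₁ d.1 + (1 - t : ℝ) * φ₂ d.2 := by
  set f₁ : A →ₗ[ℂ] ℂ := φ.toLinearMap ∘ₗ LinearMap.inl ℂ A B
  set f₂ : B →ₗ[ℂ] ℂ := φ.toLinearMap ∘ₗ LinearMap.inr ℂ A B
  have hf₁ : ∀ a, 0 ≤ f₁ (star a * a) := fun a => by
    simpa [f₁, Prod.mul_def, Prod.star_def] using φ.2.2 (a, 0)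
  have hf₂ : ∀ a, 0 ≤ f₂ (star a * a) := fun a => by
    simpa [f₂, Prod.mul_def, Prod.star_def] using φ.2.2 (0, a)
  have hadd : ∀ d, φ d = f₁ d.1 + f₂ d.2 := fun d => by
    simp [f₁, f₂, ← apply_add]
  obtain ⟨φ₁, h₁⟩ := exists_eq_mul_of_nonneg hf₁
  obtain ⟨φ₂, h₂⟩ := exists_eq_mul_of_nonneg hf₂
  have hsum : (f₁ 1).re + (f₂ 1).re = 1 := by
    have := congrArg Complex.re (hadd 1)
    simpa using this.symm
  have p1 := re_nonneg_of_nonneg hf₁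
  have p2 := re_nonneg_of_nonneg hf₂
  refine ⟨(f₁ 1).re, ⟨p1, by linarith⟩, φ₁, φ₂, fun d => ?_⟩
  rw [hadd, h₁, h₂, show 1 - (f₁ 1).re = (f₂ 1).re by linarith]

end StateSpace

theorem StateSpace.continuous_of_continuous_apply {A : Type u} [CStarAlgebra A] {X : Type*}
    [TopologicalSpace X] {f : X → StateSpace A}
    (h : ∀ a : selfAdjoint A, Continuous fun x => f x (a : A)) : Continuous f := by
  refine continuous_induced_rng.2 (WeakDual.continuous_of_continuous_eval fun a => ?_)
  refine ((h (realPart a)).add ((h (imaginaryPart a)).const_smul Complex.I)).congr fun x => ?_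
  conv_rhs => rw [← realPart_add_I_smul_imaginaryPart a]
  exact ((StateSpace.apply_add (f x) _ _).trans (by rw [StateSpace.apply_smul]; rfl)).symm

theorem StateSpace.tendsto_of_forall_apply {A : Type u} [CStarAlgebra A] {X : Type*}
    {l : Filter X} {f : X → StateSpace A} {φ : StateSpace A}
    (h : ∀ a, Filter.Tendsto (fun x => f x a) l (nhds (φ a))) : Filter.Tendsto f l (nhds φ) :=
  tendsto_subtype_rng.2 ((WeakBilin.tendsto_iff_forall_eval_tendsto _
    ContinuousLinearMap.coe_injective).2 h)

theorem totallyBounded_prod {X Y : Type*} [PseudoMetricSpace X] [PseudoMetricSpace Y] {s : Set X}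
    {t : Set Y} (hs : TotallyBounded s) (ht : TotallyBounded t) : TotallyBounded (s ×ˢ t) := by
  rw [Metric.totallyBounded_iff] at *
  intro ε hε
  obtain ⟨u, hu, hsu⟩ := hs ε hε
  obtain ⟨v, hv, htv⟩ := ht ε hε
  refine ⟨u ×ˢ v, hu.prod hv, fun x hx => ?_⟩
  obtain ⟨y, hy, hxy⟩ := Set.mem_iUnion₂.1 (hsu hx.1)
  obtain ⟨z, hz, hxz⟩ := Set.mem_iUnion₂.1 (htv hx.2)
  exact Set.mem_iUnion₂.2 ⟨(y, z), ⟨hy, hz⟩, Metric.mem_ball.2 (max_lt hxy hxz)⟩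

theorem exists_pos_ofReal_le {ε : ℝ≥0∞} (hε : 0 < ε) :
    ∃ e : ℝ, 0 < e ∧ ENNReal.ofReal e < ε := by
  obtain ⟨e, he, he'⟩ := ENNReal.lt_iff_exists_real_btwn.1 hε
  exact ⟨e, ENNReal.ofReal_pos.1 he'.1, he'.2⟩

/-! ### The Monge–Kantorovich metric -/

section MongeKantorovich

open Filter Topology

variable {A : Type u} [CStarAlgebra A] {L : selfAdjoint A → ℝ≥0∞}

theorem mkDist_self (L : selfAdjoint A → ℝ≥0∞) (φ : StateSpace A) : mkDist L φ φ = 0 :=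
  (mkPseudoEMetric L).edist_self φ

theorem mkDist_comm (L : selfAdjoint A → ℝ≥0∞) (φ ψ : StateSpace A) :
    mkDist L φ ψ = mkDist L ψ φ :=
  (mkPseudoEMetric L).edist_comm φ ψ

theorem mkDist_triangle (L : selfAdjoint A → ℝ≥0∞) (φ ψ χ : StateSpace A) :
    mkDist L φ χ ≤ mkDist L φ ψ + mkDist L ψ χ :=
  (mkPseudoEMetric L).edist_triangle φ ψ χ

theorem mkDist_le_ofReal_iff {φ ψ : StateSpace A} {s : ℝ} (hs : 0 ≤ s) :
    mkDist L φ ψ ≤ ENNReal.ofReal s ↔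
      ∀ a : selfAdjoint A, L a ≤ 1 → ‖φ (a : A) - ψ (a : A)‖ ≤ s := by
  rw [mkDist, iSup₂_le_iff]
  refine forall₂_congr fun a _ => ?_
  rw [← ofReal_norm, ENNReal.ofReal_le_ofReal_iff hs]

theorem norm_sub_le_of_mkDist_le (hsmul : ∀ (t : ℝ) (a), L (t • a) = ‖t‖ₑ * L a)
    {φ ψ : StateSpace A} {r s : ℝ} (hr : 0 < r) (hs : 0 ≤ s)
    (hφψ : mkDist L φ ψ ≤ ENNReal.ofReal s) {a : selfAdjoint A} (ha : L a ≤ ENNReal.ofReal r) :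
    ‖φ (a : A) - ψ (a : A)‖ ≤ r * s := by
  have h1 : L (r⁻¹ • a) ≤ 1 := by
    rw [hsmul, Real.enorm_of_nonneg (inv_nonneg.2 hr.le)]
    refine (mul_le_mul_right ha _).trans ?_
    rw [← ENNReal.ofReal_mul (inv_nonneg.2 hr.le), inv_mul_cancel₀ hr.ne', ENNReal.ofReal_one]
  have h2 := (mkDist_le_ofReal_iff hs).1 hφψ _ h1
  rw [selfAdjoint.val_smul, StateSpace.apply_real_smul, StateSpace.apply_real_smul, ← mul_sub,
    norm_mul, Complex.norm_real, Real.norm_of_nonneg (inv_nonneg.2 hr.le)] at h2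
  rwa [inv_mul_le_iff₀ hr] at h2

theorem mk_topology_iff : (mkPseudoEMetric L).toUniformSpace.toTopologicalSpace =
    (inferInstance : TopologicalSpace (StateSpace A)) ↔
      ∀ φ : StateSpace A,
        (𝓝 φ).HasBasis (fun ε : ℝ≥0∞ => 0 < ε) fun ε => {ψ | mkDist L ψ φ < ε} := by
  have h (φ : StateSpace A) := @Metric.nhds_basis_eball _ (mkPseudoEMetric L) φ
  constructor
  · intro hL φ
    have := h φ
    rw [hL] at this
    exact this
  · intro hL
    exact TopologicalSpace.ext_nhds fun φ => (h φ).eq_of_same_basis (hL φ)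

theorem stateHausdorff_univ_le {T : Set (StateSpace A)} {r : ℝ≥0∞}
    (h : ∀ φ, ∃ ψ ∈ T, mkDist L φ ψ ≤ r) : stateHausdorff L Set.univ T ≤ r := by
  let := mkPseudoEMetric L
  exact Metric.hausdorffEDist_le_of_mem_edist (fun φ _ => h φ)
    fun φ _ => ⟨φ, Set.mem_univ _, (mkDist_self L φ).le.trans zero_le⟩

theorem exists_mkDist_lt {T : Set (StateSpace A)} {r : ℝ≥0∞}
    (h : stateHausdorff L Set.univ T < r) (φ : StateSpace A) : ∃ ψ ∈ T, mkDist L φ ψ < r := by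
  let := mkPseudoEMetric L
  exact Metric.exists_edist_lt_of_hausdorffEDist_lt (Set.mem_univ φ) h

theorem mkDist_le_stateDiam (φ ψ : StateSpace A) : mkDist L φ ψ ≤ stateDiam L := by
  let := mkPseudoEMetric L
  exact Metric.edist_le_ediam_of_mem (Set.mem_univ φ) (Set.mem_univ ψ)

theorem stateDiam_le {r : ℝ≥0∞} (h : ∀ φ ψ, mkDist L φ ψ ≤ r) : stateDiam L ≤ r := by
  let := mkPseudoEMetric L
  exact Metric.ediam_le fun φ _ ψ _ => h φ ψ

theorem mkDist_mix_le {φ ψ : StateSpace A} {t : ℝ} (ht : t ∈ Set.Icc (0 : ℝ) 1) (h0 : 0 < t) {s : ℝ}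
    (hs : 0 ≤ s) (h : mkDist L (StateSpace.mix t ht φ ψ) ψ ≤ ENNReal.ofReal s) :
    mkDist L φ ψ ≤ ENNReal.ofReal (t⁻¹ * s) := by
  rw [mkDist_le_ofReal_iff hs] at h
  rw [mkDist_le_ofReal_iff (by positivity)]
  intro a ha
  have h1 := h a ha
  rw [StateSpace.mix_apply, show (t : ℂ) * φ (a : A) + (1 - t : ℝ) * ψ (a : A) - ψ (a : A) =
    t * (φ (a : A) - ψ (a : A)) by push_cast; ring, norm_mul, Complex.norm_real,
    Real.norm_of_nonneg h0.le] at h1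
  rwa [le_inv_mul_iff₀ h0]

/-- The Monge–Kantorovich metric is finite, since the state space is convex. -/
theorem exists_mkDist_le (hL : (mkPseudoEMetric L).toUniformSpace.toTopologicalSpace =
    (inferInstance : TopologicalSpace (StateSpace A))) :
    ∃ R : ℝ, 0 ≤ R ∧ ∀ φ ψ : StateSpace A, mkDist L φ ψ ≤ ENNReal.ofReal R := by
  rw [mk_topology_iff] at hL
  rcases isEmpty_or_nonempty (StateSpace A) with hA | ⟨⟨φ₀⟩⟩
  · exact ⟨0, le_rfl, fun φ => hA.elim φ⟩
  have hfin : ∀ φ, ∃ s : ℝ, 0 ≤ s ∧ mkDist L φ φ₀ ≤ ENNReal.ofReal s := fun φ => by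
    have hI : ∀ n : ℕ, (1 / ((n : ℝ) + 1)) ∈ Set.Icc (0 : ℝ) 1 := fun n =>
      ⟨by positivity, by rw [div_le_one (by positivity)]; linarith [n.cast_nonneg (α := ℝ)]⟩
    -- Mixtures with little weight on `φ` tend to `φ₀` weak*, hence for the metric. One of them is
    -- within 1 of `φ₀`, and rescaling by its weight bounds the distance from `φ` itself.
    have htend : Tendsto (fun n : ℕ => StateSpace.mix _ (hI n) φ φ₀) atTop (𝓝 φ₀) := by
      refine StateSpace.tendsto_of_forall_apply fun a => ?_
      have h1 : Tendsto (fun n : ℕ => ((1 / ((n : ℝ) + 1) : ℝ) : ℂ)) atTop (𝓝 ((0 : ℝ) : ℂ)) :=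
        (Complex.continuous_ofReal.tendsto _).comp tendsto_one_div_add_atTop_nhds_zero_nat
      have h2 : Tendsto (fun n : ℕ => ((1 - 1 / ((n : ℝ) + 1) : ℝ) : ℂ)) atTop
          (𝓝 ((1 - 0 : ℝ) : ℂ)) :=
        (Complex.continuous_ofReal.tendsto _).comp
          (tendsto_const_nhds.sub tendsto_one_div_add_atTop_nhds_zero_nat)
      have h3 := (h1.mul_const (φ a)).add (h2.mul_const (φ₀ a))
      refine Tendsto.congr (fun n => (StateSpace.mix_apply φ φ₀ _ (hI n) a).symm) ?_
      simpa using h3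
    have hev := htend ((hL φ₀).mem_of_mem (i := 1) one_pos)
    obtain ⟨n, hn⟩ := (Filter.eventually_map.1 hev).exists
    have hn' : mkDist L (StateSpace.mix _ (hI n) φ φ₀) φ₀ ≤ ENNReal.ofReal 1 := by
      rw [ENNReal.ofReal_one]; exact le_of_lt hn
    exact ⟨_, by positivity, mkDist_mix_le (hI n) (by positivity) zero_le_one hn'⟩
  choose s hs hsd using hfin
  obtain ⟨t, -, ht⟩ := isCompact_univ.elim_nhds_subcover
    (fun φ : StateSpace A => {ψ | mkDist L ψ φ < 1}) fun φ _ => (hL φ).mem_of_mem one_pos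
  have hR : ∀ φ, mkDist L φ φ₀ ≤ ENNReal.ofReal (1 + ∑ χ ∈ t, s χ) := fun φ => by
    obtain ⟨χ, hχ, hφχ⟩ := Set.mem_iUnion₂.1 (ht (Set.mem_univ φ))
    rw [ENNReal.ofReal_add zero_le_one (Finset.sum_nonneg fun χ _ => hs χ), ENNReal.ofReal_one]
    refine (mkDist_triangle L φ χ φ₀).trans (add_le_add (le_of_lt hφχ) ((hsd χ).trans ?_))
    exact ENNReal.ofReal_le_ofReal (Finset.single_le_sum (fun χ _ => hs χ) hχ)
  have h0 : 0 ≤ 1 + ∑ χ ∈ t, s χ := add_nonneg zero_le_one (Finset.sum_nonneg fun χ _ => hs χ)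
  refine ⟨_, add_nonneg h0 h0, fun φ ψ => (mkDist_triangle L φ φ₀ ψ).trans ?_⟩
  rw [ENNReal.ofReal_add h0 h0]
  exact add_le_add (hR φ) (mkDist_comm L φ₀ ψ ▸ hR ψ)

/-- If the Monge–Kantorovich metric induces the weak* topology, then the unit ball of `L` is totally
bounded modulo scalars. -/
theorem totallyBounded_of_mk_topology [Nontrivial A]
    (hL : (mkPseudoEMetric L).toUniformSpace.toTopologicalSpace =
      (inferInstance : TopologicalSpace (StateSpace A))) (μ : StateSpace A) :
    TotallyBounded {a : selfAdjoint A | L a ≤ 1 ∧ μ (a : A) = 0} := by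
  obtain ⟨R, hR0, hR⟩ := exists_mkDist_le hL
  rw [mk_topology_iff] at hL
  refine Metric.totallyBounded_of_finite_discretization fun ε hε => ?_
  have hε' : 0 < ENNReal.ofReal (ε / 5) := ENNReal.ofReal_pos.2 (by positivity)
  -- States norm self-adjoint elements, so values on a finite net of states determine an element of
  -- the Lip unit ball up to small error. The five parts of `ε` are four approximations and a margin
  -- for strictness.
  obtain ⟨t, -, ht⟩ := isCompact_univ.elim_nhds_subcover
    (fun φ : StateSpace A => {ψ | mkDist L ψ φ < ENNReal.ofReal (ε / 5)})
    fun φ _ => (hL φ).mem_of_mem hε'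
  have hTB : TotallyBounded (Metric.closedBall (0 : t → ℂ) R) :=
    (isCompact_closedBall _ _).totallyBounded
  obtain ⟨N, hN, hcov⟩ := Metric.totallyBounded_iff.1 hTB (ε / 5) (by positivity)
  have hx : ∀ a : {a : selfAdjoint A | L a ≤ 1 ∧ μ (a : A) = 0},
      ∃ y : N, dist (fun χ : t => χ.1 ((a : selfAdjoint A) : A)) y < ε / 5 := fun a => by
    have : (fun χ : t => χ.1 ((a : selfAdjoint A) : A)) ∈ Metric.closedBall (0 : t → ℂ) R := by
      rw [mem_closedBall_zero_iff, pi_norm_le_iff_of_nonneg hR0]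
      intro χ
      have := (mkDist_le_ofReal_iff hR0).1 (hR χ μ) a a.2.1
      rwa [a.2.2, sub_zero] at this
    obtain ⟨y, hy, hay⟩ := Set.mem_iUnion₂.1 (hcov this)
    exact ⟨⟨y, hy⟩, hay⟩
  choose G hG using hx
  have := hN.fintype
  -- the discretization records an approximation of the values at the states of the net
  obtain ⟨k, ⟨e⟩⟩ := Finite.exists_equiv_fin N
  refine ⟨ULift (Fin k), inferInstance, fun a => ⟨e (G a)⟩, fun a b hab => ?_⟩
  have hab' : G a = G b := e.injective (ULift.up_injective hab)
  rw [dist_eq_norm]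
  refine lt_of_le_of_lt (StateSpace.norm_le_of_forall_state _ (r := 4 * (ε / 5)) fun φ => ?_)
    (by linarith)
  obtain ⟨χ, hχ, hφχ⟩ := Set.mem_iUnion₂.1 (ht (Set.mem_univ φ))
  have h1 := (mkDist_le_ofReal_iff (by positivity)).1 (le_of_lt hφχ) a a.2.1
  have h2 := (mkDist_le_ofReal_iff (by positivity)).1 (le_of_lt hφχ) b b.2.1
  have h3 := (dist_le_pi_dist _ _ (⟨χ, hχ⟩ : t)).trans (hG a).le
  have h4 := (dist_le_pi_dist _ _ (⟨χ, hχ⟩ : t)).trans (hG b).le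
  rw [← hab', dist_comm] at h4
  rw [dist_eq_norm] at h3 h4
  rw [AddSubgroupClass.coe_sub, StateSpace.apply_sub]
  have e1 : φ ((a : selfAdjoint A) : A) - φ ((b : selfAdjoint A) : A) =
      (φ ((a : selfAdjoint A) : A) - χ ((a : selfAdjoint A) : A)) +
      (χ ((a : selfAdjoint A) : A) - (G a : t → ℂ) ⟨χ, hχ⟩) +
      ((G a : t → ℂ) ⟨χ, hχ⟩ - χ ((b : selfAdjoint A) : A)) -
      (φ ((b : selfAdjoint A) : A) - χ ((b : selfAdjoint A) : A)) := by ring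
  rw [e1]
  refine (norm_sub_le _ _).trans ?_
  have := norm_add₃_le (a := φ ((a : selfAdjoint A) : A) - χ ((a : selfAdjoint A) : A))
    (b := χ ((a : selfAdjoint A) : A) - (G a : t → ℂ) ⟨χ, hχ⟩)
    (c := (G a : t → ℂ) ⟨χ, hχ⟩ - χ ((b : selfAdjoint A) : A))
  linarith

/-- If the unit ball of `L` is totally bounded modulo scalars, then the Monge–Kantorovich metric
induces the weak* topology. -/
theorem mk_topology_of_totallyBounded (hadd : ∀ a b, L (a + b) ≤ L a + L b)
    (hsmul : ∀ (t : ℝ) (a), L (t • a) = ‖t‖ₑ * L a) (hdense : Dense {a | L a < ∞})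
    (hone : L 1 = 0) {μ : StateSpace A}
    (hTB : TotallyBounded {a : selfAdjoint A | L a ≤ 1 ∧ μ (a : A) = 0}) :
    (mkPseudoEMetric L).toUniformSpace.toTopologicalSpace =
      (inferInstance : TopologicalSpace (StateSpace A)) := by
  apply le_antisymm
  · rw [← continuous_id_iff_le]
    refine @StateSpace.continuous_of_continuous_apply _ _ _ (_) _ fun a => ?_
    refine (@EMetric.continuous_iff _ _ (mkPseudoEMetric L) _ _).2 ?_
    intro φ ε hε
    obtain ⟨e, he0, heε⟩ := exists_pos_ofReal_le hε
    obtain ⟨b, hb, hab⟩ := Metric.dense_iff.1 hdense a (e / 4) (by positivity)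
    have hab' : ‖a - b‖ < e / 4 := by rwa [← dist_eq_norm, dist_comm]
    set r := (L b).toReal + 1
    have hr : 0 < r := by positivity
    have hLb : L b ≤ ENNReal.ofReal r := by
      rw [← ENNReal.ofReal_toReal (ne_of_lt hab)]
      exact ENNReal.ofReal_le_ofReal (by simp [r])
    refine ⟨ENNReal.ofReal (e / 4 / r), ENNReal.ofReal_pos.2 (by positivity), fun ψ hψ => ?_⟩
    have h1 := norm_sub_le_of_mkDist_le hsmul hr (by positivity) (le_of_lt hψ) hLb
    rw [mul_div_cancel₀ _ hr.ne'] at h1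
    have h2 := (φ.norm_apply_le (a - b)).trans hab'.le
    have h3 := (ψ.norm_apply_le (a - b)).trans hab'.le
    rw [AddSubgroupClass.coe_sub, StateSpace.apply_sub] at h2 h3
    refine lt_of_le_of_lt ?_ heε
    rw [edist_dist, dist_eq_norm]
    refine ENNReal.ofReal_le_ofReal ?_
    change ‖ψ (a : A) - φ (a : A)‖ ≤ e
    rw [show ψ (a : A) - φ (a : A) = (ψ (a : A) - ψ (b : A)) + (ψ (b : A) - φ (b : A)) -
      (φ (a : A) - φ (b : A)) by ring]
    refine (norm_sub_le _ _).trans ?_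
    have := norm_add_le (ψ (a : A) - ψ (b : A)) (ψ (b : A) - φ (b : A))
    linarith
  · refine le_of_nhds_le_nhds fun φ => ?_
    rw [(@Metric.nhds_basis_eball _ (mkPseudoEMetric L) φ).ge_iff]
    intro ε hε
    obtain ⟨e, he0, heε⟩ := exists_pos_ofReal_le hε
    obtain ⟨s, hs, hcov⟩ := Metric.totallyBounded_iff.1 hTB (e / 3) (by positivity)
    have hU : (⋂ b ∈ s, {ψ : StateSpace A | dist (ψ (b : A)) (φ (b : A)) < e / 3}) ∈ 𝓝 φ :=
      (Filter.biInter_mem hs).2 fun b _ =>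
        (StateSpace.continuous_apply (b : A)).continuousAt.preimage_mem_nhds
          (Metric.ball_mem_nhds _ (by positivity))
    refine Filter.mem_of_superset hU fun ψ hψ => lt_of_le_of_lt ?_ heε
    refine (mkDist_le_ofReal_iff he0.le).2 fun a ha => ?_
    -- The translate lies in the totally bounded slice, and differences of states do not see
    -- scalars.
    set a' : selfAdjoint A := a + (-(μ (a : A)).re) • 1 with ha'
    have hone' : ((1 : selfAdjoint A) : A) = 1 := rfl
    have hval : ∀ χ : StateSpace A, χ (a' : A) = χ (a : A) - μ (a : A) := fun χ => by
      rw [ha', AddSubgroup.coe_add, selfAdjoint.val_smul, StateSpace.apply_add,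
        StateSpace.apply_real_smul, hone', StateSpace.apply_one]
      push_cast
      rw [μ.coe_re_apply]; ring
    have hmem : a' ∈ {a : selfAdjoint A | L a ≤ 1 ∧ μ (a : A) = 0} := by
      refine ⟨(hadd _ _).trans ?_, by rw [hval, sub_self]⟩
      rw [hsmul, hone, mul_zero, add_zero]
      exact ha
    obtain ⟨b, hb, hab⟩ := Set.mem_iUnion₂.1 (hcov hmem)
    have h1 := Set.mem_iInter₂.1 hψ b hb
    rw [Set.mem_ofPred_eq, dist_eq_norm] at h1
    rw [Metric.mem_ball, dist_eq_norm] at hab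
    have h2 := (φ.norm_apply_le (a' - b)).trans hab.le
    have h3 := (ψ.norm_apply_le (a' - b)).trans hab.le
    rw [AddSubgroupClass.coe_sub, StateSpace.apply_sub] at h2 h3
    rw [show ψ (a : A) - φ (a : A) = (ψ (a' : A) - ψ (b : A)) + (ψ (b : A) - φ (b : A)) -
        (φ (a' : A) - φ (b : A)) by rw [hval, hval]; ring]
    refine (norm_sub_le _ _).trans ?_
    have := norm_add_le (ψ (a' : A) - ψ (b : A)) (ψ (b : A) - φ (b : A))
    linarith

end MongeKantorovich

/-! ### Normalisation by scalars and total boundedness of bounded Lip balls -/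

namespace QLQCMS

variable {F : ℝ≥0 × ℝ≥0 × ℝ≥0 × ℝ≥0 → ℝ≥0}

theorem exists_diam_le (A : QLQCMS.{u} F) : ∃ R : ℝ, 0 ≤ R ∧ A.diam ≤ ENNReal.ofReal R := by
  obtain ⟨R, hR, h⟩ := exists_mkDist_le A.isLipNorm.mk_topology
  exact ⟨R, hR, stateDiam_le h⟩

theorem mkDist_le_diam (A : QLQCMS.{u} F) (φ ψ : StateSpace A) :
    mkDist A.lip φ ψ ≤ A.diam :=
  mkDist_le_stateDiam φ ψ

theorem lip_one (A : QLQCMS.{u} F) : A.lip 1 = 0 :=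
  (A.isLipNorm.eq_zero_iff 1).2 ⟨1, (one_smul _ _).symm⟩

theorem lip_add_smul_one (A : QLQCMS.{u} F) (a : selfAdjoint A) (t : ℝ) :
    A.lip (a + t • 1) ≤ A.lip a := by
  refine (A.isLipNorm.add_le _ _).trans ?_
  rw [A.isLipNorm.smul_eq, A.lip_one, mul_zero, add_zero]

theorem norm_add_smul_one_le (A : QLQCMS.{u} F) (μ : StateSpace A) {K r : ℝ} (hK : 0 ≤ K)
    (hr : 0 < r) (hA : A.diam ≤ ENNReal.ofReal K) {a : selfAdjoint A}
    (ha : A.lip a ≤ ENNReal.ofReal r) : ‖a + (-(μ (a : A)).re) • 1‖ ≤ r * K := by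
  refine StateSpace.norm_le_of_forall_state _ fun φ => ?_
  have hone' : ((1 : selfAdjoint A) : A) = 1 := rfl
  have h1 := norm_sub_le_of_mkDist_le A.isLipNorm.smul_eq hr hK
    ((A.mkDist_le_diam φ μ).trans hA) ha
  rw [AddSubgroup.coe_add, selfAdjoint.val_smul, StateSpace.apply_add,
        StateSpace.apply_real_smul, hone', StateSpace.apply_one]
  push_cast
  rwa [μ.coe_re_apply, mul_one, ← sub_eq_add_neg]

/-- Every self-adjoint element can be translated by a scalar to have norm at most
`diam(A) * L(a)`. -/
theorem exists_norm_add_smul_one_le (A : QLQCMS.{u} F) {K r : ℝ} (hK : 0 ≤ K) (hr : 0 < r)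
    (hA : A.diam ≤ ENNReal.ofReal K) {a : selfAdjoint A} (ha : A.lip a ≤ ENNReal.ofReal r) :
    ∃ t : ℝ, ‖a + t • 1‖ ≤ r * K := by
  obtain ⟨μ⟩ := (inferInstance : Nonempty (StateSpace A))
  exact ⟨_, A.norm_add_smul_one_le μ hK hr hA ha⟩

theorem totallyBounded_unitBall_inter_closedBall (A : QLQCMS.{u} F) (R : ℝ) :
    TotallyBounded {a : selfAdjoint A | A.lip a ≤ 1 ∧ ‖a‖ ≤ R} := by
  obtain ⟨μ⟩ := (inferInstance : Nonempty (StateSpace A))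
  have h1 := totallyBounded_of_mk_topology A.isLipNorm.mk_topology μ
  have h2 : TotallyBounded (Set.Icc (-R) R) := isCompact_Icc.totallyBounded
  have hG : UniformContinuous fun x : selfAdjoint A × ℝ => x.1 + x.2 • (1 : selfAdjoint A) :=
    uniformContinuous_fst.add
      (((ContinuousLinearMap.id ℝ ℝ).smulRight (1 : selfAdjoint A)).uniformContinuous.comp
        uniformContinuous_snd)
  have h3 := (totallyBounded_prod h1 h2).image hG
  refine TotallyBounded.subset ?_ h3
  refine fun a ha => ⟨(a + (-(μ (a : A)).re) • 1, (μ (a : A)).re),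
    ⟨⟨(A.lip_add_smul_one _ _).trans ha.1, ?_⟩, abs_le.1 ?_⟩, ?_⟩
  · have hone' : ((1 : selfAdjoint A) : A) = 1 := rfl
    rw [AddSubgroup.coe_add, selfAdjoint.val_smul, StateSpace.apply_add,
        StateSpace.apply_real_smul, hone', StateSpace.apply_one]
    push_cast
    rw [μ.coe_re_apply]; ring
  · exact (Complex.abs_re_le_norm _).trans ((μ.norm_apply_le a).trans ha.2)
  · simp

end QLQCMS

/-! ### Gluing quantum compact metric spaces -/

section StarHom

variable {A B C : Type u} [CStarAlgebra A] [CStarAlgebra B] [CStarAlgebra C]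

theorem continuous_starAlgHom (p : A →⋆ₐ[ℂ] B) : Continuous p :=
  AddMonoidHomClass.continuous_of_bound p 1
    (by simpa only [one_mul] using NonUnitalStarAlgHom.norm_apply_le p)

theorem continuous_saMap (p : A →⋆ₐ[ℂ] B) : Continuous (saMap p) :=
  ((continuous_starAlgHom p).comp continuous_subtype_val).subtype_mk _

@[simp]
theorem coe_saMap (p : A →⋆ₐ[ℂ] B) (a : selfAdjoint A) : (saMap p a : B) = p a := rfl

theorem saMap_add (p : A →⋆ₐ[ℂ] B) (a b : selfAdjoint A) :
    saMap p (a + b) = saMap p a + saMap p b :=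
  Subtype.ext (map_add p _ _)

theorem saMap_smul (p : A →⋆ₐ[ℂ] B) (t : ℝ) (a : selfAdjoint A) :
    saMap p (t • a) = t • saMap p a := by
  apply Subtype.ext
  rw [coe_saMap, selfAdjoint.val_smul, selfAdjoint.val_smul, ← Complex.coe_smul, map_smul,
    Complex.coe_smul, coe_saMap]

theorem saMap_one (p : A →⋆ₐ[ℂ] B) : saMap p 1 = 1 :=
  Subtype.ext (map_one p)

theorem saMap_jordan (p : A →⋆ₐ[ℂ] B) (a b : selfAdjoint A) :
    saMap p (jordan a b) = jordan (saMap p a) (saMap p b) :=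
  Subtype.ext (by simp only [coe_saMap, jordan, map_smul, map_add, map_mul])

theorem saMap_lie (p : A →⋆ₐ[ℂ] B) (a b : selfAdjoint A) :
    saMap p (lie a b) = lie (saMap p a) (saMap p b) :=
  Subtype.ext (by simp only [coe_saMap, lie, map_smul, map_sub, map_mul])

theorem saMap_comp (q : B →⋆ₐ[ℂ] C) (p : A →⋆ₐ[ℂ] B) (a : selfAdjoint A) :
    saMap (q.comp p) a = saMap q (saMap p a) := rfl

theorem norm_saMap_le (p : A →⋆ₐ[ℂ] B) (a : selfAdjoint A) : ‖saMap p a‖ ≤ ‖a‖ :=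
  NonUnitalStarAlgHom.norm_apply_le p (a : A)

/-- The pair of two self-adjoint elements. -/
def saProd (a : selfAdjoint A) (b : selfAdjoint B) : selfAdjoint (A × B) :=
  ⟨(a, b), by rw [selfAdjoint.mem_iff, Prod.star_def]; simp [selfAdjoint.star_val_eq]⟩

theorem saProd_eta (d : selfAdjoint (A × B)) :
    saProd (saMap (StarAlgHom.fst ℂ A B) d) (saMap (StarAlgHom.snd ℂ A B) d) = d := rfl

theorem uniformContinuous_saProd :
    UniformContinuous fun x : selfAdjoint A × selfAdjoint B => saProd x.1 x.2 :=
  ((uniformContinuous_subtype_val.comp uniformContinuous_fst).prodMk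
    (uniformContinuous_subtype_val.comp uniformContinuous_snd)).subtype_mk _

theorem continuous_saProd :
    Continuous fun x : selfAdjoint A × selfAdjoint B => saProd x.1 x.2 :=
  uniformContinuous_saProd.continuous

theorem IsQuotientSeminorm.comp {LA : selfAdjoint A → ℝ≥0∞} {LB : selfAdjoint B → ℝ≥0∞}
    {LC : selfAdjoint C → ℝ≥0∞} {q : B →⋆ₐ[ℂ] C} {p : A →⋆ₐ[ℂ] B}
    (hq : IsQuotientSeminorm q LB LC) (hp : IsQuotientSeminorm p LA LB) :
    IsQuotientSeminorm (q.comp p) LA LC := by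
  intro c
  rw [hq c]
  apply le_antisymm
  · refine le_iInf₂ fun a ha => ?_
    refine (iInf₂_le (saMap p a) ha).trans ?_
    rw [hp]
    exact iInf_le_of_le a (iInf_le _ rfl)
  · refine le_iInf₂ fun b hb => ?_
    rw [hp b]
    refine le_iInf₂ fun a ha => iInf₂_le a ?_
    rw [saMap_comp, ha, hb]

theorem IsQuotientSeminorm.le {LA : selfAdjoint A → ℝ≥0∞} {LB : selfAdjoint B → ℝ≥0∞}
    {p : A →⋆ₐ[ℂ] B} (hp : IsQuotientSeminorm p LA LB) (a : selfAdjoint A) :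
    LB (saMap p a) ≤ LA a := by
  rw [hp]
  exact iInf_le_of_le a (iInf_le _ rfl)

theorem IsQuotientSeminorm.exists_lt {LA : selfAdjoint A → ℝ≥0∞} {LB : selfAdjoint B → ℝ≥0∞}
    {p : A →⋆ₐ[ℂ] B} (hp : IsQuotientSeminorm p LA LB) {b : selfAdjoint B} {r : ℝ≥0∞}
    (hb : LB b < r) : ∃ a, saMap p a = b ∧ LA a < r := by
  rw [hp] at hb
  simpa [iInf_lt_iff] using hb

theorem isQuotientSeminorm_id (L : selfAdjoint A → ℝ≥0∞) :
    IsQuotientSeminorm (StarAlgHom.id ℂ A) L L := by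
  intro a
  refine le_antisymm (le_iInf₂ fun b hb => ?_) (iInf_le_of_le a (iInf_le _ rfl))
  rw [← hb]
  exact le_rfl

theorem norm_mul_sub_mul_le (x y x' y' : A) :
    ‖x * y - x' * y'‖ ≤ ‖x‖ * ‖y - y'‖ + ‖y'‖ * ‖x - x'‖ := by
  rw [show x * y - x' * y' = x * (y - y') + (x - x') * y' by noncomm_ring]
  refine (norm_add_le _ _).trans (add_le_add (norm_mul_le _ _) ?_)
  rw [mul_comm ‖y'‖]
  exact norm_mul_le _ _

theorem norm_mul_sub_mul_le' (x y x' y' : A) :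
    ‖y * x - y' * x'‖ ≤ ‖x‖ * ‖y - y'‖ + ‖y'‖ * ‖x - x'‖ := by
  rw [show y * x - y' * x' = (y - y') * x + y' * (x - x') by noncomm_ring]
  refine (norm_add_le _ _).trans (add_le_add ?_ (norm_mul_le _ _))
  rw [mul_comm ‖x‖]
  exact norm_mul_le _ _

theorem norm_jordan_sub_jordan_le (a b a' b' : selfAdjoint A) :
    ‖jordan a b - jordan a' b'‖ ≤ ‖a‖ * ‖b - b'‖ + ‖b'‖ * ‖a - a'‖ := by
  have h1 := norm_mul_sub_mul_le (a : A) b a' b'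
  have h2 := norm_mul_sub_mul_le' (a : A) b a' b'
  change ‖(1 / 2 : ℂ) • ((a : A) * b + b * a) - (1 / 2 : ℂ) • ((a' : A) * b' + b' * a')‖ ≤
    ‖(a : A)‖ * ‖(b : A) - b'‖ + ‖(b' : A)‖ * ‖(a : A) - a'‖
  rw [← smul_sub, add_sub_add_comm, norm_smul]
  have h3 := norm_add_le ((a : A) * b - a' * b') ((b : A) * a - b' * a')
  have h4 : ‖(1 / 2 : ℂ)‖ = 1 / 2 := by simp
  rw [h4]
  linarith

theorem norm_lie_sub_lie_le (a b a' b' : selfAdjoint A) :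
    ‖lie a b - lie a' b'‖ ≤ ‖a‖ * ‖b - b'‖ + ‖b'‖ * ‖a - a'‖ := by
  have h1 := norm_mul_sub_mul_le (a : A) b a' b'
  have h2 := norm_mul_sub_mul_le' (a : A) b a' b'
  change ‖(1 / (2 * Complex.I) : ℂ) • ((a : A) * b - b * a) -
      (1 / (2 * Complex.I) : ℂ) • ((a' : A) * b' - b' * a')‖ ≤
    ‖(a : A)‖ * ‖(b : A) - b'‖ + ‖(b' : A)‖ * ‖(a : A) - a'‖
  rw [← smul_sub, sub_sub_sub_comm, norm_smul]
  have h3 := norm_sub_le ((a : A) * b - a' * b') ((b : A) * a - b' * a')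
  have h4 : ‖(1 / (2 * Complex.I) : ℂ)‖ = 1 / 2 := by simp
  rw [h4]
  linarith

end StarHom

section Glue

variable {F : ℝ≥0 × ℝ≥0 × ℝ≥0 × ℝ≥0 → ℝ≥0} (D₁ D₂ : QLQCMS.{u} F)
  {E : Type u} [CStarAlgebra E] (p : D₁ →⋆ₐ[ℂ] E) (q : D₂ →⋆ₐ[ℂ] E) (c : ℝ≥0)

/-- The Lip-norm `max (L₁ d₁) (L₂ d₂) (c ‖p d₁ - q d₂‖)` on `D₁ × D₂`. -/
noncomputable def glueLip (d : selfAdjoint (D₁ × D₂)) : ℝ≥0∞ :=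
  max (max (D₁.lip (saMap (StarAlgHom.fst ℂ D₁ D₂) d)) (D₂.lip (saMap (StarAlgHom.snd ℂ D₁ D₂) d)))
    ((c * ‖saMap p (saMap (StarAlgHom.fst ℂ D₁ D₂) d) -
      saMap q (saMap (StarAlgHom.snd ℂ D₁ D₂) d)‖₊ : ℝ≥0) : ℝ≥0∞)

theorem lip_fst_le_glueLip (d : selfAdjoint (D₁ × D₂)) :
    D₁.lip (saMap (StarAlgHom.fst ℂ D₁ D₂) d) ≤ glueLip D₁ D₂ p q c d :=
  (le_max_left _ _).trans (le_max_left _ _)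

theorem lip_snd_le_glueLip (d : selfAdjoint (D₁ × D₂)) :
    D₂.lip (saMap (StarAlgHom.snd ℂ D₁ D₂) d) ≤ glueLip D₁ D₂ p q c d :=
  (le_max_right _ _).trans (le_max_left _ _)

theorem mul_nnnorm_le_glueLip (d : selfAdjoint (D₁ × D₂)) :
    ((c * ‖saMap p (saMap (StarAlgHom.fst ℂ D₁ D₂) d) -
      saMap q (saMap (StarAlgHom.snd ℂ D₁ D₂) d)‖₊ : ℝ≥0) : ℝ≥0∞) ≤ glueLip D₁ D₂ p q c d :=
  le_max_right _ _

variable {c}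

theorem norm_sub_le_of_glueLip_le (hc : 0 < c) {d : selfAdjoint (D₁ × D₂)}
    (hd : glueLip D₁ D₂ p q c d ≤ 1) :
    ‖saMap p (saMap (StarAlgHom.fst ℂ D₁ D₂) d) -
      saMap q (saMap (StarAlgHom.snd ℂ D₁ D₂) d)‖ ≤ (c : ℝ)⁻¹ := by
  have h := (mul_nnnorm_le_glueLip D₁ D₂ p q c d).trans hd
  rw [← ENNReal.coe_one, ENNReal.coe_le_coe] at h
  rw [← one_div, le_div_iff₀ (by exact_mod_cast hc), mul_comm]
  exact_mod_cast h

/-- The normalisation at `μ` bounds the first coordinate. The diameter bounds the second only up to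
a scalar, and that scalar is controlled because `p d₁` and `q d₂` are within `c⁻¹` in `E`. The slice
therefore lies in a product of two totally bounded sets. -/
theorem totallyBounded_glueLip [Nontrivial E] (hc : 0 < c) (μ : StateSpace D₁) :
    TotallyBounded {d : selfAdjoint (D₁ × D₂) | glueLip D₁ D₂ p q c d ≤ 1 ∧
      StateSpace.comap (StarAlgHom.fst ℂ D₁ D₂) μ (d : D₁ × D₂) = 0} := by
  obtain ⟨K₁, hK₁, h₁⟩ := D₁.exists_diam_le
  obtain ⟨K₂, hK₂, h₂⟩ := D₂.exists_diam_le
  have hTB := (totallyBounded_prod (D₁.totallyBounded_unitBall_inter_closedBall K₁)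
    (D₂.totallyBounded_unitBall_inter_closedBall (K₂ + (K₂ + K₁ + (c : ℝ)⁻¹)))).image
      uniformContinuous_saProd
  refine TotallyBounded.subset ?_ hTB
  refine fun d hd => ⟨(saMap (StarAlgHom.fst ℂ D₁ D₂) d, saMap (StarAlgHom.snd ℂ D₁ D₂) d),
    ⟨⟨(lip_fst_le_glueLip D₁ D₂ p q c d).trans hd.1, ?_⟩,
      ⟨(lip_snd_le_glueLip D₁ D₂ p q c d).trans hd.1, ?_⟩⟩, rfl⟩
  all_goals
    set d₁ := saMap (StarAlgHom.fst ℂ D₁ D₂) d with hd₁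
    set d₂ := saMap (StarAlgHom.snd ℂ D₁ D₂) d with hd₂
    have e₁ : ‖d₁‖ ≤ K₁ := by
      have := D₁.norm_add_smul_one_le μ hK₁ one_pos h₁ (a := d₁)
        (by rw [ENNReal.ofReal_one]; exact (lip_fst_le_glueLip D₁ D₂ p q c d).trans hd.1)
      have h0 : μ (d₁ : D₁) = 0 := hd.2
      rwa [h0, Complex.zero_re, neg_zero, zero_smul, add_zero, one_mul] at this
  · exact e₁
  · obtain ⟨t, ht⟩ := D₂.exists_norm_add_smul_one_le hK₂ one_pos h₂ (a := d₂)
        (by rw [ENNReal.ofReal_one]; exact (lip_snd_le_glueLip D₁ D₂ p q c d).trans hd.1)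
    rw [one_mul] at ht
    have e₂ := norm_sub_le_of_glueLip_le D₁ D₂ p q hc hd.1
    have e₃ := (norm_saMap_le p d₁).trans e₁
    have e₄ := (norm_saMap_le q (d₂ + t • 1)).trans ht
    rw [saMap_add, saMap_smul, saMap_one] at e₄
    have hone : ∀ (B : Type u) [CStarAlgebra B] [Nontrivial B], ‖(1 : selfAdjoint B)‖ = 1 :=
      fun B _ _ => norm_one (α := B)
    have e₅ : |t| ≤ K₂ + K₁ + (c : ℝ)⁻¹ := by
      have : ‖t • (1 : selfAdjoint E)‖ = |t| := by
        rw [norm_smul, hone, mul_one, Real.norm_eq_abs]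
      rw [← this, show t • (1 : selfAdjoint E) = (saMap q d₂ + t • 1) - saMap p d₁ +
        (saMap p d₁ - saMap q d₂) by abel]
      refine (norm_add_le _ _).trans (add_le_add ((norm_sub_le _ _).trans (add_le_add e₄ e₃)) e₂)
    rw [show d₂ = d₂ + t • 1 - t • 1 by abel]
    refine (norm_sub_le _ _).trans (add_le_add ht ?_)
    rwa [norm_smul, hone, mul_one, Real.norm_eq_abs]

variable {D₁ D₂ p q}

/-- The common core of the Jordan and Lie estimates. The legs use monotonicity of `F`; the bridge
term satisfies a Leibniz rule, which is absorbed by `x l_y + y l_x ≤ F`. -/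
theorem glueLip_product_le (hF : Permissible F) {a b x : selfAdjoint (D₁ × D₂)}
    (ha : glueLip D₁ D₂ p q c a < ∞) (hb : glueLip D₁ D₂ p q c b < ∞)
    (h₁ : D₁.lip (saMap (StarAlgHom.fst ℂ D₁ D₂) x) ≤
      F (‖saMap (StarAlgHom.fst ℂ D₁ D₂) a‖₊, ‖saMap (StarAlgHom.fst ℂ D₁ D₂) b‖₊,
        (D₁.lip (saMap (StarAlgHom.fst ℂ D₁ D₂) a)).toNNReal,
        (D₁.lip (saMap (StarAlgHom.fst ℂ D₁ D₂) b)).toNNReal))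
    (h₂ : D₂.lip (saMap (StarAlgHom.snd ℂ D₁ D₂) x) ≤
      F (‖saMap (StarAlgHom.snd ℂ D₁ D₂) a‖₊, ‖saMap (StarAlgHom.snd ℂ D₁ D₂) b‖₊,
        (D₂.lip (saMap (StarAlgHom.snd ℂ D₁ D₂) a)).toNNReal,
        (D₂.lip (saMap (StarAlgHom.snd ℂ D₁ D₂) b)).toNNReal))
    (h : ‖saMap p (saMap (StarAlgHom.fst ℂ D₁ D₂) x) -
        saMap q (saMap (StarAlgHom.snd ℂ D₁ D₂) x)‖₊ ≤
      ‖saMap p (saMap (StarAlgHom.fst ℂ D₁ D₂) a)‖₊ *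
        ‖saMap p (saMap (StarAlgHom.fst ℂ D₁ D₂) b) - saMap q (saMap (StarAlgHom.snd ℂ D₁ D₂) b)‖₊ +
      ‖saMap q (saMap (StarAlgHom.snd ℂ D₁ D₂) b)‖₊ *
        ‖saMap p (saMap (StarAlgHom.fst ℂ D₁ D₂) a) - saMap q (saMap (StarAlgHom.snd ℂ D₁ D₂) a)‖₊) :
    glueLip D₁ D₂ p q c x ≤ F (‖(a : D₁ × D₂)‖₊, ‖(b : D₁ × D₂)‖₊,
      (glueLip D₁ D₂ p q c a).toNNReal, (glueLip D₁ D₂ p q c b).toNNReal) := by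
  have m₁ : ∀ d : selfAdjoint (D₁ × D₂), ‖saMap (StarAlgHom.fst ℂ D₁ D₂) d‖₊ ≤
      ‖(d : D₁ × D₂)‖₊ := fun d => norm_saMap_le _ d
  have m₂ : ∀ d : selfAdjoint (D₁ × D₂), ‖saMap (StarAlgHom.snd ℂ D₁ D₂) d‖₊ ≤
      ‖(d : D₁ × D₂)‖₊ := fun d => norm_saMap_le _ d
  refine max_le (max_le ?_ ?_) ?_
  · refine h₁.trans (ENNReal.coe_le_coe.2 (hF.monotone ⟨m₁ a, m₁ b, ?_, ?_⟩))
    · exact ENNReal.toNNReal_mono ha.ne (lip_fst_le_glueLip D₁ D₂ p q c a)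
    · exact ENNReal.toNNReal_mono hb.ne (lip_fst_le_glueLip D₁ D₂ p q c b)
  · refine h₂.trans (ENNReal.coe_le_coe.2 (hF.monotone ⟨m₂ a, m₂ b, ?_, ?_⟩))
    · exact ENNReal.toNNReal_mono ha.ne (lip_snd_le_glueLip D₁ D₂ p q c a)
    · exact ENNReal.toNNReal_mono hb.ne (lip_snd_le_glueLip D₁ D₂ p q c b)
  · refine ENNReal.coe_le_coe.2 (le_trans ?_ (hF.le_apply _ _ _ _))
    have ka := ENNReal.toNNReal_mono ha.ne (mul_nnnorm_le_glueLip D₁ D₂ p q c a)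
    have kb := ENNReal.toNNReal_mono hb.ne (mul_nnnorm_le_glueLip D₁ D₂ p q c b)
    rw [ENNReal.toNNReal_coe] at ka kb
    have na : ‖saMap p (saMap (StarAlgHom.fst ℂ D₁ D₂) a)‖₊ ≤ ‖(a : D₁ × D₂)‖₊ :=
      (show _ ≤ ‖saMap (StarAlgHom.fst ℂ D₁ D₂) a‖₊ from norm_saMap_le p _).trans (m₁ a)
    have nb : ‖saMap q (saMap (StarAlgHom.snd ℂ D₁ D₂) b)‖₊ ≤ ‖(b : D₁ × D₂)‖₊ :=
      (show _ ≤ ‖saMap (StarAlgHom.snd ℂ D₁ D₂) b‖₊ from norm_saMap_le q _).trans (m₂ b)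
    refine (mul_le_mul_right h c).trans ?_
    rw [mul_add, mul_left_comm, mul_left_comm c ‖saMap q _‖₊]
    exact add_le_add (mul_le_mul' na kb) (mul_le_mul' nb ka)

variable (D₁ D₂ p q)

theorem isQuasiLeibnizLipNorm_glueLip [Nontrivial E] (hF : Permissible F) (hc : 0 < c) :
    IsQuasiLeibnizLipNorm F (glueLip D₁ D₂ p q c) := by
  have hadd : ∀ a b, glueLip D₁ D₂ p q c (a + b) ≤
      glueLip D₁ D₂ p q c a + glueLip D₁ D₂ p q c b := fun a b => by
    refine max_le (max_le ?_ ?_) ?_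
    · rw [saMap_add]
      exact (D₁.isLipNorm.add_le _ _).trans
        (add_le_add (lip_fst_le_glueLip _ _ _ _ _ _) (lip_fst_le_glueLip _ _ _ _ _ _))
    · rw [saMap_add]
      exact (D₂.isLipNorm.add_le _ _).trans
        (add_le_add (lip_snd_le_glueLip _ _ _ _ _ _) (lip_snd_le_glueLip _ _ _ _ _ _))
    · refine le_trans ?_ (add_le_add (mul_nnnorm_le_glueLip D₁ D₂ p q c a)
        (mul_nnnorm_le_glueLip D₁ D₂ p q c b))
      rw [← ENNReal.coe_add, ENNReal.coe_le_coe, ← mul_add]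
      refine mul_le_mul_right ?_ c
      simp only [saMap_add]
      rw [add_sub_add_comm]
      exact nnnorm_add_le _ _
  have hsmul : ∀ (t : ℝ) (a), glueLip D₁ D₂ p q c (t • a) = ‖t‖ₑ * glueLip D₁ D₂ p q c a :=
    fun t a => by
      have hm : Monotone fun x : ℝ≥0∞ => ‖t‖ₑ * x := fun x y h => mul_le_mul_right h _
      simp only [glueLip, saMap_smul, D₁.isLipNorm.smul_eq, D₂.isLipNorm.smul_eq, ← smul_sub,
        nnnorm_smul]
      rw [hm.map_max, hm.map_max, mul_left_comm, ENNReal.coe_mul]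
      rfl
  have hdense : Dense {a | glueLip D₁ D₂ p q c a < ∞} := by
    have h := (D₁.isLipNorm.dense_dom.prod D₂.isLipNorm.dense_dom)
    have hsurj : Function.Surjective fun x : selfAdjoint D₁ × selfAdjoint D₂ => saProd x.1 x.2 :=
      fun d => ⟨(_, _), saProd_eta d⟩
    refine (hsurj.denseRange.dense_image continuous_saProd h).mono ?_
    rintro _ ⟨x, hx, rfl⟩
    exact max_lt (max_lt hx.1 hx.2) ENNReal.coe_lt_top
  have hzero : ∀ a, glueLip D₁ D₂ p q c a = 0 ↔
      ∃ t : ℝ, a = t • (1 : selfAdjoint (D₁ × D₂)) := fun a => by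
    constructor
    · intro h
      obtain ⟨t, ht⟩ := (D₁.isLipNorm.eq_zero_iff _).1
        (le_antisymm ((lip_fst_le_glueLip D₁ D₂ p q c a).trans h.le) zero_le)
      obtain ⟨s, hs⟩ := (D₂.isLipNorm.eq_zero_iff _).1
        (le_antisymm ((lip_snd_le_glueLip D₁ D₂ p q c a).trans h.le) zero_le)
      have h3 := le_antisymm ((mul_nnnorm_le_glueLip D₁ D₂ p q c a).trans h.le) zero_le
      rw [ENNReal.coe_eq_zero, mul_eq_zero, or_iff_right hc.ne', nnnorm_eq_zero, ht, hs,
        saMap_smul, saMap_smul, saMap_one, saMap_one, ← sub_smul] at h3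
      have hts : t = s := by
        have h4 := congrArg norm h3
        rw [norm_smul, norm_zero, show ‖(1 : selfAdjoint E)‖ = 1 from norm_one (α := E), mul_one,
          norm_eq_zero, sub_eq_zero] at h4
        exact h4
      refine ⟨t, ?_⟩
      rw [← saProd_eta a, ht, hs, ← hts]
      rfl
    · rintro ⟨t, rfl⟩
      rw [hsmul]
      simp only [glueLip, saMap_one, D₁.lip_one, D₂.lip_one, sub_self, nnnorm_zero, mul_zero,
        ENNReal.coe_zero, max_self]
  refine ⟨hadd, hsmul, hdense, hzero, ?_, ?_, ?_, ?_⟩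
  · have h : {a | glueLip D₁ D₂ p q c a ≤ 1} =
      (saMap (StarAlgHom.fst ℂ D₁ D₂) ⁻¹' {a | D₁.lip a ≤ 1} ∩
        saMap (StarAlgHom.snd ℂ D₁ D₂) ⁻¹' {a | D₂.lip a ≤ 1}) ∩
      {a | c * ‖saMap p (saMap (StarAlgHom.fst ℂ D₁ D₂) a) -
        saMap q (saMap (StarAlgHom.snd ℂ D₁ D₂) a)‖₊ ≤ 1} := by
      ext a
      simp only [glueLip, max_le_iff, Set.mem_ofPred_eq, Set.mem_inter_iff, Set.mem_preimage]
      rw [← ENNReal.coe_one, ENNReal.coe_le_coe]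
    rw [h]
    refine ((D₁.isLipNorm.isClosed_unitBall.preimage (continuous_saMap _)).inter
      (D₂.isLipNorm.isClosed_unitBall.preimage (continuous_saMap _))).inter ?_
    exact isClosed_le (continuous_const.mul (((continuous_saMap p).comp (continuous_saMap _)).sub
      ((continuous_saMap q).comp (continuous_saMap _))).nnnorm) continuous_const
  · obtain ⟨μ⟩ := (inferInstance : Nonempty (StateSpace D₁))
    exact mk_topology_of_totallyBounded hadd hsmul hdense
      ((hzero 1).2 ⟨1, (one_smul _ _).symm⟩) (totallyBounded_glueLip D₁ D₂ p q hc μ)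
  · intro a b ha hb
    have ha₁ := (lip_fst_le_glueLip D₁ D₂ p q c a).trans_lt ha
    have ha₂ := (lip_snd_le_glueLip D₁ D₂ p q c a).trans_lt ha
    have hb₁ := (lip_fst_le_glueLip D₁ D₂ p q c b).trans_lt hb
    have hb₂ := (lip_snd_le_glueLip D₁ D₂ p q c b).trans_lt hb
    refine glueLip_product_le hF ha hb ?_ ?_ ?_
    · rw [saMap_jordan]; exact D₁.isLipNorm.jordan_le _ _ ha₁ hb₁
    · rw [saMap_jordan]; exact D₂.isLipNorm.jordan_le _ _ ha₂ hb₂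
    · simp only [saMap_jordan]; exact norm_jordan_sub_jordan_le _ _ _ _
  · intro a b ha hb
    have ha₁ := (lip_fst_le_glueLip D₁ D₂ p q c a).trans_lt ha
    have ha₂ := (lip_snd_le_glueLip D₁ D₂ p q c a).trans_lt ha
    have hb₁ := (lip_fst_le_glueLip D₁ D₂ p q c b).trans_lt hb
    have hb₂ := (lip_snd_le_glueLip D₁ D₂ p q c b).trans_lt hb
    refine glueLip_product_le hF ha hb ?_ ?_ ?_
    · rw [saMap_lie]; exact D₁.isLipNorm.lie_le _ _ ha₁ hb₁
    · rw [saMap_lie]; exact D₂.isLipNorm.lie_le _ _ ha₂ hb₂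
    · simp only [saMap_lie]; exact norm_lie_sub_lie_le _ _ _ _

end Glue

/-! ### Tunnels obtained by gluing -/

section GlueTunnel

/-- A state of a glued space is close to a state that factors through the first leg. -/
theorem exists_mkDist_comap_le {D D₁ D₂ E A : Type u} [CStarAlgebra D] [CStarAlgebra D₁]
    [CStarAlgebra D₂] [CStarAlgebra E] [CStarAlgebra A] {L : selfAdjoint D → ℝ≥0∞}
    {L₁ : selfAdjoint D₁ → ℝ≥0∞} {L₂ : selfAdjoint D₂ → ℝ≥0∞} {pr₁ : D →⋆ₐ[ℂ] D₁}
    {pr₂ : D →⋆ₐ[ℂ] D₂} {p : D₁ →⋆ₐ[ℂ] E} {q : D₂ →⋆ₐ[ℂ] E} {π : D₁ →⋆ₐ[ℂ] A} {δ r₁ r₂ : ℝ}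
    (hδ : 0 ≤ δ) (hr₁ : 0 ≤ r₁) (hr₂ : 0 ≤ r₂) (hL₁ : ∀ d, L₁ (saMap pr₁ d) ≤ L d)
    (hL₂ : ∀ d, L₂ (saMap pr₂ d) ≤ L d)
    (hpq : ∀ d, L d ≤ 1 → ‖saMap p (saMap pr₁ d) - saMap q (saMap pr₂ d)‖ ≤ δ)
    (h₁ : ∀ φ : StateSpace D₁, ∃ ψ, mkDist L₁ φ (StateSpace.comap π ψ) ≤ ENNReal.ofReal r₁)
    (h₂ : ∀ φ : StateSpace D₂, ∃ χ, mkDist L₂ φ (StateSpace.comap q χ) ≤ ENNReal.ofReal r₂)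
    {φ : StateSpace D} {t : ℝ} (ht : t ∈ Set.Icc (0 : ℝ) 1) {φ₁ : StateSpace D₁}
    {φ₂ : StateSpace D₂} (hφ : ∀ d, φ d = t * φ₁ (pr₁ d) + (1 - t : ℝ) * φ₂ (pr₂ d)) :
    ∃ ψ ∈ Set.range (StateSpace.comap (π.comp pr₁)),
      mkDist L φ ψ ≤ ENNReal.ofReal (r₁ + r₂ + δ) := by
  obtain ⟨χ, hχ⟩ := h₂ φ₂
  -- The component on `D₂` is moved to `χ ∘ q` at cost `r₂`, then across the bridge to `χ ∘ p` at
  -- cost `δ`. The mixture is now a state of `D₁`, and reaching one that factors through `π` costs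
  -- `r₁`.
  obtain ⟨ψ, hψ⟩ := h₁ (StateSpace.mix t ht φ₁ (StateSpace.comap p χ))
  refine ⟨_, ⟨ψ, rfl⟩, (mkDist_le_ofReal_iff (by positivity)).2 fun d hd => ?_⟩
  have e₁ := (mkDist_le_ofReal_iff hr₁).1 hψ _ ((hL₁ d).trans hd)
  have e₂ := (mkDist_le_ofReal_iff hr₂).1 hχ _ ((hL₂ d).trans hd)
  have e₃ := (χ.norm_apply_le _).trans (hpq d hd)
  rw [AddSubgroupClass.coe_sub, StateSpace.apply_sub] at e₃
  rw [StateSpace.mix_apply] at e₁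
  simp only [StateSpace.comap_apply, coe_saMap] at e₁ e₂ e₃
  rw [hφ, StateSpace.comap_apply, StarAlgHom.comp_apply]
  rw [show (t : ℂ) * φ₁ (pr₁ d) + (1 - t : ℝ) * φ₂ (pr₂ d) - ψ (π (pr₁ d)) =
    (t * φ₁ (pr₁ d) + (1 - t : ℝ) * χ (p (pr₁ d)) - ψ (π (pr₁ d))) +
    (1 - t : ℝ) * ((φ₂ (pr₂ d) - χ (q (pr₂ d))) - (χ (p (pr₁ d)) - χ (q (pr₂ d)))) by ring]
  refine (norm_add_le _ _).trans ?_
  have e₄ := norm_sub_le (φ₂ (pr₂ d) - χ (q (pr₂ d))) (χ (p (pr₁ d)) - χ (q (pr₂ d)))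
  rw [norm_mul, Complex.norm_real, Real.norm_of_nonneg (sub_nonneg.2 ht.2)]
  have e₅ := mul_le_of_le_one_left
    (norm_nonneg ((φ₂ (pr₂ d) - χ (q (pr₂ d))) - (χ (p (pr₁ d)) - χ (q (pr₂ d)))))
    (show 1 - t ≤ 1 by linarith [ht.1])
  linarith

variable {F : ℝ≥0 × ℝ≥0 × ℝ≥0 × ℝ≥0 → ℝ≥0} {A₁ A₂ D₁ D₂ : QLQCMS.{u} F}
  {E : Type u} [CStarAlgebra E] {p : D₁ →⋆ₐ[ℂ] E} {q : D₂ →⋆ₐ[ℂ] E}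

theorem isQuotientSeminorm_fst {c : ℝ≥0}
    (h : ∀ (d₁ : selfAdjoint D₁) (r : ℝ≥0), 0 < r → D₁.lip d₁ < r →
      ∃ d₂ : selfAdjoint D₂, D₂.lip d₂ ≤ r ∧ c * ‖saMap p d₁ - saMap q d₂‖₊ ≤ r) :
    IsQuotientSeminorm (StarAlgHom.fst ℂ D₁ D₂) (glueLip D₁ D₂ p q c) D₁.lip := by
  intro d₁
  apply le_antisymm
  · refine le_iInf₂ fun d hd => ?_
    rw [← hd]
    exact lip_fst_le_glueLip _ _ _ _ _ _
  · refine le_of_forall_gt_imp_ge_of_dense fun r hr => ?_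
    obtain ⟨s, hs, hsr⟩ := ENNReal.lt_iff_exists_nnreal_btwn.1 hr
    obtain ⟨d₂, h₂, h₃⟩ := h d₁ s (ENNReal.coe_pos.1 (zero_le.trans_lt hs)) hs
    refine le_trans (iInf_le_of_le (saProd d₁ d₂) (iInf_le _ rfl)) (le_trans ?_ hsr.le)
    exact max_le (max_le hs.le h₂) (ENNReal.coe_le_coe.2 h₃)

theorem isQuotientSeminorm_snd {c : ℝ≥0}
    (h : ∀ (d₂ : selfAdjoint D₂) (r : ℝ≥0), 0 < r → D₂.lip d₂ < r →
      ∃ d₁ : selfAdjoint D₁, D₁.lip d₁ ≤ r ∧ c * ‖saMap p d₁ - saMap q d₂‖₊ ≤ r) :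
    IsQuotientSeminorm (StarAlgHom.snd ℂ D₁ D₂) (glueLip D₁ D₂ p q c) D₂.lip := by
  intro d₂
  apply le_antisymm
  · refine le_iInf₂ fun d hd => ?_
    rw [← hd]
    exact lip_snd_le_glueLip _ _ _ _ _ _
  · refine le_of_forall_gt_imp_ge_of_dense fun r hr => ?_
    obtain ⟨s, hs, hsr⟩ := ENNReal.lt_iff_exists_nnreal_btwn.1 hr
    obtain ⟨d₁, h₂, h₃⟩ := h d₂ s (ENNReal.coe_pos.1 (zero_le.trans_lt hs)) hs
    refine le_trans (iInf_le_of_le (saProd d₁ d₂) (iInf_le _ rfl)) (le_trans ?_ hsr.le)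
    exact max_le (max_le h₂ hs.le) (ENNReal.coe_le_coe.2 h₃)

/-- The space obtained by gluing `D₁` and `D₂` along `p` and `q`. -/
noncomputable def glueSpace [Nontrivial E] (hF : Permissible F) (p : D₁ →⋆ₐ[ℂ] E)
    (q : D₂ →⋆ₐ[ℂ] E) {c : ℝ≥0} (hc : 0 < c) : QLQCMS.{u} F where
  carrier := D₁ × D₂
  lip := glueLip D₁ D₂ p q c
  isLipNorm := isQuasiLeibnizLipNorm_glueLip D₁ D₂ p q hF hc

/-- With bridge weight `δ⁻¹`, the lifting hypotheses say exactly that each coordinate projection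
admits lifts whose bridge term does not increase the Lip-norm bound, so both projections are
quotients. -/
theorem propinquity_le_of_glue [Nontrivial E] (hF : Permissible F) {δ r₁ r₂ : ℝ} (hδ : 0 < δ)
    (hr₁ : 0 ≤ r₁) (hr₂ : 0 ≤ r₂)
    (hlift₁ : ∀ (d₁ : selfAdjoint D₁) (r : ℝ≥0), 0 < r → D₁.lip d₁ < r →
      ∃ d₂ : selfAdjoint D₂, D₂.lip d₂ ≤ r ∧ ‖saMap p d₁ - saMap q d₂‖ ≤ δ * r)
    (hlift₂ : ∀ (d₂ : selfAdjoint D₂) (r : ℝ≥0), 0 < r → D₂.lip d₂ < r →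
      ∃ d₁ : selfAdjoint D₁, D₁.lip d₁ ≤ r ∧ ‖saMap p d₁ - saMap q d₂‖ ≤ δ * r)
    {π₁ : D₁ →⋆ₐ[ℂ] A₁} {π₂ : D₂ →⋆ₐ[ℂ] A₂} (hπ₁ : Function.Surjective π₁)
    (hπ₂ : Function.Surjective π₂) (hq₁ : IsQuotientSeminorm π₁ D₁.lip A₁.lip)
    (hq₂ : IsQuotientSeminorm π₂ D₂.lip A₂.lip)
    (h₁ : ∀ φ : StateSpace D₁, ∃ ψ, mkDist D₁.lip φ (StateSpace.comap π₁ ψ) ≤ ENNReal.ofReal r₁)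
    (h₁' : ∀ φ : StateSpace D₁, ∃ ψ, mkDist D₁.lip φ (StateSpace.comap p ψ) ≤ ENNReal.ofReal r₁)
    (h₂ : ∀ φ : StateSpace D₂, ∃ ψ, mkDist D₂.lip φ (StateSpace.comap π₂ ψ) ≤ ENNReal.ofReal r₂)
    (h₂' : ∀ φ : StateSpace D₂, ∃ ψ, mkDist D₂.lip φ (StateSpace.comap q ψ) ≤ ENNReal.ofReal r₂) :
    propinquity A₁ A₂ ≤ ENNReal.ofReal (r₁ + r₂ + δ) := by
  set c : ℝ≥0 := ⟨δ⁻¹, (inv_pos.2 hδ).le⟩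
  have hc : 0 < c := inv_pos.2 hδ
  have key : ∀ (x : E) (r : ℝ≥0), ‖x‖ ≤ δ * r → c * ‖x‖₊ ≤ r := fun x r hx => by
    change δ⁻¹ * ‖x‖ ≤ r
    rwa [inv_mul_le_iff₀ hδ]
  have hfst := isQuotientSeminorm_fst (p := p) (q := q) (c := c) fun d₁ r hr hd => by
    obtain ⟨d₂, h, h'⟩ := hlift₁ d₁ r hr hd
    exact ⟨d₂, h, key (p d₁ - q d₂) r h'⟩
  have hsnd := isQuotientSeminorm_snd (p := p) (q := q) (c := c) fun d₂ r hr hd => by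
    obtain ⟨d₁, h, h'⟩ := hlift₂ d₂ r hr hd
    exact ⟨d₁, h, key (p d₁ - q d₂) r h'⟩
  let τ : Tunnel A₁ A₂ :=
    { space := glueSpace hF p q hc
      π₁ := π₁.comp (StarAlgHom.fst ℂ D₁ D₂)
      π₂ := π₂.comp (StarAlgHom.snd ℂ D₁ D₂)
      surjective₁ := hπ₁.comp Prod.fst_surjective
      surjective₂ := hπ₂.comp Prod.snd_surjective
      quotient₁ := hq₁.comp hfst
      quotient₂ := hq₂.comp hsnd }
  have hpq : ∀ d : selfAdjoint (D₁ × D₂), glueLip D₁ D₂ p q c d ≤ 1 →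
      ‖saMap p (saMap (StarAlgHom.fst ℂ D₁ D₂) d) -
        saMap q (saMap (StarAlgHom.snd ℂ D₁ D₂) d)‖ ≤ δ := fun d hd => by
    have h := norm_sub_le_of_glueLip_le D₁ D₂ p q hc hd
    have hcδ : (c : ℝ)⁻¹ = δ := inv_inv δ
    rwa [hcδ] at h
  refine (iInf_le _ τ).trans (max_le ?_ ?_)
  · refine stateHausdorff_univ_le fun φ => ?_
    obtain ⟨t, ht, φ₁, φ₂, hφ⟩ := StateSpace.exists_prod_decomposition (A := D₁) (B := D₂) φ
    exact exists_mkDist_comap_le (pr₁ := StarAlgHom.fst ℂ D₁ D₂) (pr₂ := StarAlgHom.snd ℂ D₁ D₂)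
      hδ.le hr₁ hr₂ (lip_fst_le_glueLip D₁ D₂ p q c) (lip_snd_le_glueLip D₁ D₂ p q c) hpq h₁ h₂'
      ht hφ
  · refine stateHausdorff_univ_le fun φ => ?_
    obtain ⟨t, ht, φ₁, φ₂, hφ⟩ := StateSpace.exists_prod_decomposition (A := D₁) (B := D₂) φ
    rw [add_comm r₁ r₂]
    refine exists_mkDist_comap_le (pr₁ := StarAlgHom.snd ℂ D₁ D₂)
      (pr₂ := StarAlgHom.fst ℂ D₁ D₂) (p := q) (q := p) (t := 1 - t) (φ₁ := φ₂) (φ₂ := φ₁)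
      hδ.le hr₂ hr₁ (lip_snd_le_glueLip D₁ D₂ p q c) (lip_fst_le_glueLip D₁ D₂ p q c)
      (fun d hd => norm_sub_rev (E := selfAdjoint E) _ _ ▸ hpq d hd) h₂ h₁'
      ⟨sub_nonneg.2 ht.2, sub_le_self _ ht.1⟩ fun d => ?_
    rw [hφ d, sub_sub_cancel, add_comm]
    rfl

/-! ### The dual propinquity is a pseudometric -/

/-- The tunnel traversed in the other direction. -/
def Tunnel.symm {A B : QLQCMS.{u} F} (τ : Tunnel A B) : Tunnel B A where
  space := τ.space
  π₁ := τ.π₂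
  π₂ := τ.π₁
  surjective₁ := τ.surjective₂
  surjective₂ := τ.surjective₁
  quotient₁ := τ.quotient₂
  quotient₂ := τ.quotient₁

theorem propinquity_comm (A B : QLQCMS.{u} F) : propinquity A B = propinquity B A :=
  le_antisymm (le_iInf fun τ => (iInf_le _ τ.symm).trans (max_comm _ _).le)
    (le_iInf fun τ => (iInf_le _ τ.symm).trans (max_comm _ _).le)

theorem Tunnel.exists_mkDist_comap_π₁_le {A B : QLQCMS.{u} F} (τ : Tunnel A B) {r : ℝ≥0∞}
    (h : τ.extent < r) (φ : StateSpace τ.space) :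
    ∃ ψ, mkDist τ.space.lip φ (StateSpace.comap τ.π₁ ψ) ≤ r := by
  obtain ⟨_, ⟨ψ, rfl⟩, hψ⟩ := exists_mkDist_lt ((le_max_left _ _).trans_lt h) φ
  exact ⟨ψ, hψ.le⟩

theorem Tunnel.exists_mkDist_comap_π₂_le {A B : QLQCMS.{u} F} (τ : Tunnel A B) {r : ℝ≥0∞}
    (h : τ.extent < r) (φ : StateSpace τ.space) :
    ∃ ψ, mkDist τ.space.lip φ (StateSpace.comap τ.π₂ ψ) ≤ r := by
  obtain ⟨_, ⟨ψ, rfl⟩, hψ⟩ := exists_mkDist_lt ((le_max_right _ _).trans_lt h) φ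
  exact ⟨ψ, hψ.le⟩

theorem exists_tunnel_extent_lt {A B : QLQCMS.{u} F} {r : ℝ≥0∞} (h : propinquity A B < r) :
    ∃ τ : Tunnel A B, τ.extent < r :=
  iInf_lt_iff.1 h

/-- Two tunnels are glued along their common end `B`. Both legs there are quotient maps, so lifts
can be chosen to agree exactly in `B`; the bridge width is arbitrary and uses one third of `ε`, the
near-optimal tunnels the rest. -/
theorem propinquity_triangle (hF : Permissible F) (A B C : QLQCMS.{u} F) :
    propinquity A C ≤ propinquity A B + propinquity B C := by
  refine ENNReal.le_of_forall_pos_le_add fun ε hε hfin => ?_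
  rw [ENNReal.add_lt_top] at hfin
  have hε' : (0 : ℝ) < ε / 3 := div_pos (by exact_mod_cast hε) three_pos
  have hlt : ∀ x : ℝ≥0∞, x < ∞ → x < ENNReal.ofReal (x.toReal + ε / 3) := fun x hx => by
    rw [ENNReal.lt_ofReal_iff_toReal_lt hx.ne]
    linarith
  obtain ⟨τ, hτ⟩ := exists_tunnel_extent_lt (hlt _ hfin.1)
  obtain ⟨σ, hσ⟩ := exists_tunnel_extent_lt (hlt _ hfin.2)
  have h := propinquity_le_of_glue (p := τ.π₂) (q := σ.π₁) hF hε'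
    (add_nonneg ENNReal.toReal_nonneg hε'.le) (add_nonneg ENNReal.toReal_nonneg hε'.le)
    (fun d₁ r hr hd => by
      obtain ⟨d₂, h, h'⟩ := σ.quotient₁.exists_lt ((τ.quotient₂.le d₁).trans_lt hd)
      refine ⟨d₂, h'.le, ?_⟩
      rw [h, sub_self, norm_zero]
      positivity)
    (fun d₂ r hr hd => by
      obtain ⟨d₁, h, h'⟩ := τ.quotient₂.exists_lt ((σ.quotient₁.le d₂).trans_lt hd)
      refine ⟨d₁, h'.le, ?_⟩
      rw [h, sub_self, norm_zero]
      positivity)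
    τ.surjective₁ σ.surjective₂ τ.quotient₁ σ.quotient₂
    (τ.exists_mkDist_comap_π₁_le hτ) (τ.exists_mkDist_comap_π₂_le hτ)
    (σ.exists_mkDist_comap_π₂_le hσ) (σ.exists_mkDist_comap_π₁_le hσ)
  refine h.trans (le_of_eq ?_)
  rw [show (propinquity A B).toReal + ε / 3 + ((propinquity B C).toReal + ε / 3) + ε / 3 =
    (propinquity A B).toReal + (propinquity B C).toReal + ε by ring,
    ENNReal.ofReal_add (by positivity) (by positivity),
    ENNReal.ofReal_add (by positivity) (by positivity), ENNReal.ofReal_toReal hfin.1.ne,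
    ENNReal.ofReal_toReal hfin.2.ne, ENNReal.ofReal_coe_nnreal]

/-! ### Diameters -/

theorem mkDist_comap_le {A B : Type u} [CStarAlgebra A] [CStarAlgebra B]
    {LA : selfAdjoint A → ℝ≥0∞} {LB : selfAdjoint B → ℝ≥0∞} {π : A →⋆ₐ[ℂ] B}
    (h : IsQuotientSeminorm π LA LB) (φ ψ : StateSpace B) :
    mkDist LA (StateSpace.comap π φ) (StateSpace.comap π ψ) ≤ mkDist LB φ ψ :=
  iSup₂_le fun a ha => le_iSup₂_of_le (saMap π a) ((h.le a).trans ha) le_rfl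

/-- The quotient infimum need not be attained: an element of Lip-norm at most 1 lifts with Lip-norm
below any `s > 1`, and `s` then tends to 1. -/
theorem mkDist_le_of_comap_le {A B : Type u} [CStarAlgebra A] [CStarAlgebra B]
    {LA : selfAdjoint A → ℝ≥0∞} {LB : selfAdjoint B → ℝ≥0∞} {π : A →⋆ₐ[ℂ] B}
    (hsmul : ∀ (t : ℝ) (a), LA (t • a) = ‖t‖ₑ * LA a) (h : IsQuotientSeminorm π LA LB)
    {φ ψ : StateSpace B} {r : ℝ} (hr : 0 ≤ r)
    (hφψ : mkDist LA (StateSpace.comap π φ) (StateSpace.comap π ψ) ≤ ENNReal.ofReal r) :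
    mkDist LB φ ψ ≤ ENNReal.ofReal r := by
  refine (mkDist_le_ofReal_iff hr).2 fun b hb => ?_
  have key : ∀ s : ℝ, 1 < s → ‖φ (b : B) - ψ (b : B)‖ ≤ s * r := fun s hs => by
    obtain ⟨a, rfl, ha⟩ := h.exists_lt (hb.trans_lt (ENNReal.one_lt_ofReal.2 hs))
    exact norm_sub_le_of_mkDist_le hsmul (zero_lt_one.trans hs) hr hφψ ha.le
  refine le_of_forall_pos_le_add fun ε hε => ?_
  refine (key (1 + ε / (r + 1)) (by simp; positivity)).trans ?_
  have : ε / (r + 1) * r ≤ ε := by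
    rw [div_mul_eq_mul_div, div_le_iff₀ (by positivity)]
    nlinarith
  linarith

/-- Inside a tunnel, two states coming from `A` are each moved by at most `r` to states coming from
`B`. -/
theorem diam_le_of_propinquity_lt {A B : QLQCMS.{u} F} {K r : ℝ} (hK : 0 ≤ K) (hr : 0 ≤ r)
    (hB : B.diam ≤ ENNReal.ofReal K) (h : propinquity A B < ENNReal.ofReal r) :
    A.diam ≤ ENNReal.ofReal (K + 2 * r) := by
  obtain ⟨τ, hτ⟩ := exists_tunnel_extent_lt h
  refine stateDiam_le fun φ ψ => mkDist_le_of_comap_le τ.space.isLipNorm.smul_eq τ.quotient₁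
    (by positivity) ?_
  obtain ⟨φ', hφ⟩ := τ.exists_mkDist_comap_π₂_le hτ (StateSpace.comap τ.π₁ φ)
  obtain ⟨ψ', hψ⟩ := τ.exists_mkDist_comap_π₂_le hτ (StateSpace.comap τ.π₁ ψ)
  have h1 := (mkDist_comap_le τ.quotient₂ φ' ψ').trans ((B.mkDist_le_diam φ' ψ').trans hB)
  rw [mkDist_comm] at hψ
  refine (mkDist_triangle _ _ _ _).trans ((add_le_add hφ ((mkDist_triangle _ _ _ _).trans
    (add_le_add h1 hψ))).trans (le_of_eq ?_))
  rw [← ENNReal.ofReal_add hK hr, ← ENNReal.ofReal_add hr (add_nonneg hK hr)]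
  congr 1
  ring

end GlueTunnel

/-! ### Finite dimensional C*-algebras -/

section FiniteDimensional

theorem eq_zero_of_star_mul_self_pow_eq_zero {A : Type u} [CStarAlgebra A] {a : A} {n : ℕ}
    (h : (star a * a) ^ n = 0) : a = 0 := by
  have h1 := (IsSelfAdjoint.star_mul_self a).nnnorm_pow_two_pow n
  have h2 : (star a * a) ^ 2 ^ n = 0 := pow_eq_zero_of_le n.lt_two_pow_self.le h
  rw [h2, nnnorm_zero] at h1
  have h3 := eq_zero_of_pow_eq_zero h1.symm
  rwa [nnnorm_eq_zero, CStarRing.star_mul_self_eq_zero_iff] at h3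

/-- The Jacobson radical is nilpotent; it contains `star a * a` along with `a`, and a nilpotent
`star a * a` forces `a = 0`. -/
instance isSemisimpleRing_of_finiteDimensional (A : Type u) [CStarAlgebra A]
    [FiniteDimensional ℂ A] : IsSemisimpleRing A := by
  have : IsArtinianRing A := IsArtinianRing.of_finite ℂ A
  rw [IsArtinianRing.isSemisimpleRing_iff_jacobson, eq_bot_iff]
  obtain ⟨n, hn⟩ := IsSemiprimaryRing.isNilpotent (R := A)
  intro a ha
  have h1 := Ideal.pow_mem_pow (Ideal.mul_mem_left _ (star a) ha) n
  rw [hn] at h1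
  exact eq_zero_of_star_mul_self_pow_eq_zero h1

/-! ### The regular trace as a faithful positive functional -/

section Trace

variable (A : Type u) [CStarAlgebra A]

/-- The trace of the left regular representation. -/
noncomputable def regTrace : A →ₗ[ℂ] ℂ :=
  LinearMap.trace ℂ A ∘ₗ (Algebra.lmul ℂ A).toLinearMap

variable {A}

theorem regTrace_apply (a : A) : regTrace A a = LinearMap.trace ℂ A (LinearMap.mulLeft ℂ a) := rfl

theorem regTrace_algEquiv {B : Type u} [CStarAlgebra B] (f : A ≃ₐ[ℂ] B) (a : A) :
    regTrace B (f a) = regTrace A a := by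
  rw [regTrace_apply, regTrace_apply, ← LinearMap.trace_conj' _ f.toLinearEquiv]
  congr 1
  ext b
  simp [LinearEquiv.conj_apply]

variable [FiniteDimensional ℂ A]

theorem nonneg_of_mem_roots_charpoly_mulLeft {a : A} {z : ℂ}
    (hz : z ∈ (LinearMap.mulLeft ℂ (star a * a)).charpoly.roots) : 0 ≤ z := by
  let := CStarAlgebra.spectralOrder A
  let := CStarAlgebra.spectralOrderedRing A
  have h1 := (Module.End.hasEigenvalue_iff_isRoot_charpoly _ _).2
    (Polynomial.isRoot_of_mem_roots hz)
  obtain ⟨x, hx⟩ := h1.exists_hasEigenvector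
  refine spectrum_nonneg_of_nonneg (star_mul_self_nonneg a) (spectrum.mem_iff.2 fun hu => hx.2 ?_)
  rw [← hu.mul_right_eq_zero, sub_mul, Algebra.algebraMap_eq_smul_one, smul_mul_assoc, one_mul,
    sub_eq_zero]
  exact hx.apply_eq_smul.symm

theorem regTrace_star_mul_self (a : A) : regTrace A (star a * a) =
    (LinearMap.mulLeft ℂ (star a * a)).charpoly.roots.sum :=
  Module.End.trace_eq_sum_roots_charpoly_of_splits (IsAlgClosed.splits _)

theorem regTrace_nonneg (a : A) : 0 ≤ regTrace A (star a * a) := by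
  rw [regTrace_star_mul_self]
  exact Multiset.sum_nonneg fun z => nonneg_of_mem_roots_charpoly_mulLeft

/-- Nonnegative eigenvalues with zero sum all vanish, so the characteristic polynomial is a power of
`X`; Cayley–Hamilton, evaluated at 1, makes `star a * a` nilpotent. -/
theorem eq_zero_of_regTrace_eq_zero {a : A} (h : regTrace A (star a * a) = 0) : a = 0 := by
  rw [regTrace_star_mul_self] at h
  set T := LinearMap.mulLeft ℂ (star a * a) with hT
  have h1 := Multiset.all_zero_of_le_zero_le_of_sum_eq_zero
    (fun z => nonneg_of_mem_roots_charpoly_mulLeft) h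
  have h2 := (IsAlgClosed.splits T.charpoly).eq_prod_roots_of_monic T.charpoly_monic
  rw [Multiset.eq_replicate_card.2 h1, Multiset.map_replicate, Multiset.prod_replicate,
    Polynomial.C_0, sub_zero] at h2
  have h3 := LinearMap.aeval_self_charpoly T
  rw [h2, map_pow, Polynomial.aeval_X, hT, LinearMap.pow_mulLeft] at h3
  have h4 := congrArg (fun S : A →ₗ[ℂ] A => S 1) h3
  simp only [LinearMap.mulLeft_apply, mul_one, LinearMap.zero_apply] at h4
  exact eq_zero_of_star_mul_self_pow_eq_zero h4

end Trace

/-- Stated for a bare vector space with a core, so that the trace norm does not compete with the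
C*-norm when `V` is the algebra. -/
theorem iSup_eigenspace_eq_top_of_core {V : Type u} [AddCommGroup V] [Module ℂ V]
    [FiniteDimensional ℂ V] (c : InnerProductSpace.Core ℂ V) (T : V →ₗ[ℂ] V)
    (hT : ∀ x y, c.inner (T x) y = c.inner x (T y)) :
    ⨆ μ, Module.End.eigenspace T μ = ⊤ := by
  let : NormedAddCommGroup V := c.toNormedAddCommGroup
  let : InnerProductSpace ℂ V := InnerProductSpace.ofCore c.toCore
  have h : T.IsSymmetric := hT
  exact Submodule.orthogonal_eq_bot_iff.1 h.orthogonalComplement_iSup_eigenspaces_eq_bot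

theorem induction_eigenspace {V : Type u} [AddCommGroup V] [Module ℂ V] {T : Module.End ℂ V}
    (hT : ⨆ μ, T.eigenspace μ = ⊤) {P : V → Prop} (h : ∀ μ, ∀ x ∈ T.eigenspace μ, P x) (h0 : P 0)
    (hadd : ∀ x y, P x → P y → P (x + y)) (x : V) : P x :=
  Submodule.iSup_induction (motive := P) _
    (hT ▸ Submodule.mem_top : x ∈ ⨆ μ, T.eigenspace μ) h h0 hadd

/-! ### From algebra isomorphisms to *-isomorphisms -/

section Automorphism

variable {A : Type u} [CStarAlgebra A] [FiniteDimensional ℂ A]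

/-- A function on the eigenvalues of a diagonalizable operator extends to the operator. -/
theorem exists_functional_calculus (T : Module.End ℂ A) (s : ℂ → ℂ) :
    ∃ S : Module.End ℂ A, ∀ μ, ∀ x ∈ T.eigenspace μ, S x = s μ • x := by
  classical
  have hfin := Module.End.finite_hasEigenvalue T
  refine ⟨Polynomial.aeval T (Lagrange.interpolate hfin.toFinset id s), fun μ x hx => ?_⟩
  by_cases h0 : x = 0
  · rw [h0, map_zero, smul_zero]
  · have hv : T.HasEigenvector μ x := ⟨hx, h0⟩
    rw [Module.End.aeval_apply_of_hasEigenvector hv]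
    congr 1
    exact Lagrange.eval_interpolate_at_node (v := id) s (Set.injOn_id _)
      (by simpa using Module.End.hasEigenvalue_of_hasEigenvector hv)

/-- Finite dimensional C*-algebras that are isomorphic as algebras are *-isomorphic. -/
theorem nonempty_starAlgEquiv_of_algEquiv {B : Type u} [CStarAlgebra B] [FiniteDimensional ℂ B]
    (f : A ≃ₐ[ℂ] B) : Nonempty (A ≃⋆ₐ[ℂ] B) := by
  -- `σ` is the involution of `B` carried to `A`, and `α = star ∘ σ` is an algebra automorphism. If
  -- `β` is its positive square root, then `β` intertwines `σ` with `star`, so `f ∘ β⁻¹` preserves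
  -- the involutions.
  set σ : A → A := fun x => f.symm (star (f x)) with hσ
  have hσσ : ∀ x, σ (σ x) = x := fun x => by simp [hσ]
  -- the product of the two involutions
  let α : Module.End ℂ A :=
    { toFun := fun x => star (σ x)
      map_add' := fun x y => by simp [hσ]
      map_smul' := fun c x => by simp [hσ] }
  have hα : ∀ x, α x = star (σ x) := fun x => rfl
  have hα_mul : ∀ x y, α (x * y) = α x * α y := fun x y => by simp [hα, hσ]
  have hα_star : ∀ x, α (star (α x)) = star x := fun x => by rw [hα, hα, star_star, hσσ]
  -- For the trace form on `A`, `α` represents the trace form of `B`; hence `α` is symmetric and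
  -- positive definite.
  have htr : ∀ x y, regTrace A (star (α x) * y) = regTrace B (star (f x) * f y) := fun x y => by
    rw [hα, star_star, ← regTrace_algEquiv f, map_mul]
    simp [hσ]
  let core : InnerProductSpace.Core ℂ A :=
    { inner := fun x y => regTrace A (star x * y)
      conj_inner_symm := fun x y => by
        have := map_star_of_nonneg regTrace_nonneg (star y * x)
        rw [star_mul, star_star] at this
        exact this.symm
      re_inner_nonneg := fun x => (Complex.nonneg_iff.1 (regTrace_nonneg x)).1
      add_left := fun x y z => by simp [add_mul]
      smul_left := fun x y r => by simp
      definite := fun x => eq_zero_of_regTrace_eq_zero }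
  have htop : ⨆ μ, α.eigenspace μ = ⊤ := by
    refine iSup_eigenspace_eq_top_of_core core α fun x y => ?_
    change regTrace A (star (α x) * y) = regTrace A (star x * α y)
    have h1 := map_star_of_nonneg regTrace_nonneg (star (α y) * x)
    rw [star_mul, star_star] at h1
    have h2 := map_star_of_nonneg regTrace_nonneg (star (f y) * f x)
    rw [star_mul, star_star] at h2
    rw [h1, htr, htr, h2]
  have hpos : ∀ μ, ∀ x ∈ α.eigenspace μ, x ≠ 0 → 0 < μ.re ∧ μ = μ.re := fun μ x hx h0 => by
    have h1 := htr x x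
    rw [Module.End.mem_eigenspace_iff.1 hx, star_smul, smul_mul_assoc, map_smul, smul_eq_mul] at h1
    have h2 : 0 < regTrace A (star x * x) :=
      lt_of_le_of_ne (regTrace_nonneg x) fun h => h0 (eq_zero_of_regTrace_eq_zero h.symm)
    have h3 : 0 < regTrace B (star (f x) * f x) :=
      lt_of_le_of_ne (regTrace_nonneg _) fun h => h0 (by
        simpa using eq_zero_of_regTrace_eq_zero h.symm)
    rw [← h1] at h3
    have h4 : 0 < star μ := (pos_iff_pos_of_mul_pos h3).2 h2
    rw [Complex.pos_iff] at h4
    simp only [Complex.star_def, Complex.conj_re, Complex.conj_im] at h4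
    exact ⟨h4.1, Complex.ext rfl (by simpa using h4.2.symm)⟩
  obtain ⟨β, hβ⟩ := exists_functional_calculus α fun μ => (Real.sqrt μ.re : ℂ)
  have hβ_mul : ∀ x y, β (x * y) = β x * β y := by
    refine induction_eigenspace htop (fun μ x hx => ?_) (by simp) fun x x' h h' y => by
      simp only [add_mul, map_add, h, h']
    refine induction_eigenspace htop (fun ν y hy => ?_) (by simp) fun y y' h h' => by
      simp only [mul_add, map_add, h, h']
    by_cases hx0 : x = 0
    · simp [hx0]
    by_cases hy0 : y = 0
    · simp [hy0]
    obtain ⟨hμ, hμ'⟩ := hpos μ x hx hx0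
    obtain ⟨hν, hν'⟩ := hpos ν y hy hy0
    -- Multiplicativity of `α` multiplies eigenvalues, and the square root is multiplicative on
    -- positive reals, so `β` inherits multiplicativity.
    have hxy : x * y ∈ α.eigenspace (μ * ν) := by
      rw [Module.End.mem_eigenspace_iff, hα_mul, Module.End.mem_eigenspace_iff.1 hx,
        Module.End.mem_eigenspace_iff.1 hy, smul_mul_smul_comm]
    rw [hβ _ _ hxy, hβ _ _ hx, hβ _ _ hy, smul_mul_smul_comm]
    congr 1
    rw [hμ', hν', ← Complex.ofReal_mul, Complex.ofReal_re, Complex.ofReal_re, Complex.ofReal_re,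
      Real.sqrt_mul hμ.le, Complex.ofReal_mul]
  have hβ_one : β 1 = 1 := by
    have h1 : (1 : A) ∈ α.eigenspace 1 := by
      rw [Module.End.mem_eigenspace_iff, one_smul]
      simp [hα, hσ]
    simp [hβ 1 1 h1]
  have hβ_sq : ∀ x, β (β x) = α x := by
    refine induction_eigenspace htop (fun μ x hx => ?_) (by simp) fun x x' h h' => by
      simp only [map_add, h, h']
    by_cases hx0 : x = 0
    · simp [hx0]
    obtain ⟨hμ, hμ'⟩ := hpos μ x hx hx0
    rw [hβ _ _ hx, map_smul, hβ _ _ hx, smul_smul, Module.End.mem_eigenspace_iff.1 hx,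
      ← Complex.ofReal_mul, Real.mul_self_sqrt hμ.le, ← hμ']
  have hβ_star : ∀ x, β (σ x) = star (β x) := by
    refine induction_eigenspace htop (fun μ x hx => ?_) (by simp [hσ]) fun x x' h h' => by
      have : σ (x + x') = σ x + σ x' := by simp [hσ]
      simp only [this, map_add, h, h', star_add]
    by_cases hx0 : x = 0
    · simp [hx0, hσ]
    obtain ⟨hμ, hμ'⟩ := hpos μ x hx hx0
    have hαx := Module.End.mem_eigenspace_iff.1 hx
    have hμ0 : (μ.re : ℂ) ≠ 0 := by exact_mod_cast hμ.ne'
    rw [hμ'] at hαx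
    have hσx : σ x = (μ.re : ℂ) • star x := by
      rw [← star_star (σ x), ← hα, hαx, star_smul, Complex.star_def, Complex.conj_ofReal]
    -- Thus `β (σ x) = μ · μ^(-1/2) • star x = √μ • star x`, which is `star (β x)`.
    have hsx : star x ∈ α.eigenspace ((μ.re⁻¹ : ℝ) : ℂ) := by
      have h1 := hα_star x
      rw [hαx, star_smul, Complex.star_def, Complex.conj_ofReal, map_smul] at h1
      rw [Module.End.mem_eigenspace_iff, ← h1, smul_smul, ← Complex.ofReal_mul,
        inv_mul_cancel₀ hμ.ne', Complex.ofReal_one, one_smul]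
      rw [h1]
    rw [hσx, map_smul, hβ _ _ hsx, hβ _ _ hx, smul_smul, star_smul, Complex.star_def,
      Complex.conj_ofReal, Complex.ofReal_re, ← Complex.ofReal_mul, Real.sqrt_inv]
    congr 2
    rw [← div_eq_mul_inv, Real.div_sqrt]
  have hβ_inj : Function.Injective β := by
    rw [← LinearMap.ker_eq_bot, LinearMap.ker_eq_bot']
    intro x hx
    have h1 := hβ_sq x
    rw [hx, map_zero, hα, eq_comm, star_eq_zero] at h1
    rw [← hσσ x, h1]
    simp [hσ]
  have hβ_bij : Function.Bijective β := ⟨hβ_inj, LinearMap.surjective_of_injective hβ_inj⟩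
  let e : A ≃ₐ[ℂ] A := AlgEquiv.ofBijective (AlgHom.ofLinearMap β hβ_one hβ_mul) hβ_bij
  refine ⟨StarAlgEquiv.ofAlgEquiv (e.symm.trans f) fun x => ?_⟩
  obtain ⟨y, rfl⟩ := e.surjective x
  have h1 : star (e y) = e (σ y) := (hβ_star y).symm
  rw [h1]
  simp [hσ]

end Automorphism

/-- Up to isomorphism, there are finitely many C*-algebras of dimension at most `N`. -/
theorem exists_algEquiv_pi_matrix (A : Type u) [CStarAlgebra A] [FiniteDimensional ℂ A] {N : ℕ}
    (hN : Module.finrank ℂ A ≤ N) : ∃ k : Σ n : Fin (N + 1), Fin n → Fin (N + 1),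
      Nonempty (A ≃ₐ[ℂ] ((i : Fin k.1) → Matrix (Fin (k.2 i)) (Fin (k.2 i)) ℂ)) := by
  obtain ⟨n, d, hd, ⟨e⟩⟩ := IsSemisimpleRing.exists_algEquiv_pi_matrix_of_isAlgClosed ℂ A
  -- Every block size is at least 1, so this bounds both the number of blocks and each size.
  have hsum : ∑ i, d i * d i ≤ N := by
    rw [e.toLinearEquiv.finrank_eq, Module.finrank_pi_fintype] at hN
    simpa [Module.finrank_matrix] using hN
  have hd1 : ∀ i, 1 ≤ d i := fun i => Nat.one_le_iff_ne_zero.2 (hd i).out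
  have hn : n ≤ N := by
    refine le_trans ?_ hsum
    calc n = ∑ i : Fin n, 1 := by simp
      _ ≤ _ := Finset.sum_le_sum fun i _ => Nat.mul_le_mul (hd1 i) (hd1 i)
  have hdN : ∀ i, d i ≤ N := fun i => (Nat.le_mul_self (d i)).trans
    ((Finset.single_le_sum (f := fun i => d i * d i) (fun _ _ => Nat.zero_le _)
      (Finset.mem_univ i)).trans hsum)
  exact ⟨⟨⟨n, Nat.lt_succ_of_le hn⟩, fun i => ⟨d i, Nat.lt_succ_of_le (hdN i)⟩⟩, ⟨e⟩⟩

end FiniteDimensional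

/-! ### Total boundedness of bounded classes of finite dimensional spaces -/

section Coloring

variable {F : ℝ≥0 × ℝ≥0 × ℝ≥0 × ℝ≥0 → ℝ≥0}

/-- Scaling by `r⁻¹` and translating by a scalar brings `a` into the bounded unit ball. The
approximant found there is transported back by the same operations, since `p` and `q` are unital. -/
theorem exists_lift_of_unitBall_close {B B' : QLQCMS.{u} F} {E : Type u} [CStarAlgebra E]
    {p : B →⋆ₐ[ℂ] E} {q : B' →⋆ₐ[ℂ] E} {K δ : ℝ} (hK : 0 ≤ K) (hB : B.diam ≤ ENNReal.ofReal K)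
    (h : ∀ a : selfAdjoint B, B.lip a ≤ 1 → ‖a‖ ≤ K →
      ∃ b : selfAdjoint B', B'.lip b ≤ 1 ∧ ‖saMap p a - saMap q b‖ ≤ δ)
    (a : selfAdjoint B) (r : ℝ≥0) (hr : 0 < r) (ha : B.lip a < r) :
    ∃ b : selfAdjoint B', B'.lip b ≤ r ∧ ‖saMap p a - saMap q b‖ ≤ δ * r := by
  have hr' : (0 : ℝ) < r := hr
  have h1 : B.lip ((r : ℝ)⁻¹ • a) ≤ 1 := by
    rw [B.isLipNorm.smul_eq, Real.enorm_of_nonneg (inv_nonneg.2 hr'.le)]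
    refine (mul_le_mul_right ha.le _).trans ?_
    rw [← ENNReal.ofReal_coe_nnreal, ← ENNReal.ofReal_mul (inv_nonneg.2 hr'.le),
      inv_mul_cancel₀ hr'.ne', ENNReal.ofReal_one]
  obtain ⟨t, ht⟩ := B.exists_norm_add_smul_one_le hK one_pos hB
    (by rwa [ENNReal.ofReal_one] : B.lip ((r : ℝ)⁻¹ • a) ≤ ENNReal.ofReal 1)
  rw [one_mul] at ht
  obtain ⟨b, hb, hab⟩ := h _ ((B.lip_add_smul_one _ t).trans h1) ht
  refine ⟨(r : ℝ) • (b + (-t) • 1), ?_, ?_⟩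
  · rw [B'.isLipNorm.smul_eq, Real.enorm_of_nonneg hr'.le, ENNReal.ofReal_coe_nnreal]
    exact mul_le_of_le_one_right' ((B'.lip_add_smul_one _ _).trans hb)
  · have e : saMap p a - saMap q ((r : ℝ) • (b + (-t) • 1)) =
        (r : ℝ) • (saMap p ((r : ℝ)⁻¹ • a + t • 1) - saMap q b) := by
      simp only [saMap_add, saMap_smul, saMap_one]
      simp only [smul_sub, smul_add, smul_smul,
        mul_inv_cancel₀ hr'.ne', one_smul, neg_smul, smul_neg]
      abel
    rw [e, norm_smul, Real.norm_of_nonneg hr'.le, mul_comm]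
    exact mul_le_mul_of_nonneg_right hab hr'.le

theorem exists_mkDist_comap_starAlgEquiv_le (B : QLQCMS.{u} F) {E : Type u} [CStarAlgebra E]
    (ρ : B ≃⋆ₐ[ℂ] E) (φ : StateSpace B) :
    ∃ ψ, mkDist B.lip φ (StateSpace.comap ρ.toStarAlgHom ψ) ≤ ENNReal.ofReal 0 := by
  refine ⟨StateSpace.comap ρ.symm.toStarAlgHom φ, ?_⟩
  have h : StateSpace.comap ρ.toStarAlgHom (StateSpace.comap ρ.symm.toStarAlgHom φ) = φ := by
    ext a
    rw [StateSpace.comap_apply, StateSpace.comap_apply]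
    exact congrArg φ.1 (ρ.symm_apply_apply a)
  rw [h, mkDist_self]
  exact zero_le

theorem propinquity_le_of_unitBall_close (hF : Permissible F) {B B' : QLQCMS.{u} F} {E : Type u}
    [CStarAlgebra E] [Nontrivial E] (ρ : B ≃⋆ₐ[ℂ] E) (ρ' : B' ≃⋆ₐ[ℂ] E) {K δ : ℝ} (hK : 0 ≤ K)
    (hδ : 0 < δ) (hB : B.diam ≤ ENNReal.ofReal K) (hB' : B'.diam ≤ ENNReal.ofReal K)
    (h : ∀ a : selfAdjoint B, B.lip a ≤ 1 → ‖a‖ ≤ K →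
      ∃ b : selfAdjoint B', B'.lip b ≤ 1 ∧ ‖ρ (a : B) - ρ' (b : B')‖ ≤ δ)
    (h' : ∀ b : selfAdjoint B', B'.lip b ≤ 1 → ‖b‖ ≤ K →
      ∃ a : selfAdjoint B, B.lip a ≤ 1 ∧ ‖ρ' (b : B') - ρ (a : B)‖ ≤ δ) :
    propinquity B B' ≤ ENNReal.ofReal δ := by
  have h1 := propinquity_le_of_glue (p := ρ.toStarAlgHom) (q := ρ'.toStarAlgHom) hF hδ le_rfl le_rfl
    (exists_lift_of_unitBall_close hK hB h)
    (fun d₂ r hr hd => by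
      obtain ⟨d₁, h1, h2⟩ := exists_lift_of_unitBall_close (p := ρ'.toStarAlgHom)
        (q := ρ.toStarAlgHom) hK hB' h' d₂ r hr hd
      exact ⟨d₁, h1, norm_sub_rev (E := selfAdjoint E) _ _ ▸ h2⟩)
    (π₁ := StarAlgHom.id ℂ B) (π₂ := StarAlgHom.id ℂ B') Function.surjective_id
    Function.surjective_id (isQuotientSeminorm_id _) (isQuotientSeminorm_id _)
    (fun φ => ⟨φ, (mkDist_self _ φ).le.trans zero_le⟩)
    (exists_mkDist_comap_starAlgEquiv_le B ρ)
    (fun φ => ⟨φ, (mkDist_self _ φ).le.trans zero_le⟩)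
    (exists_mkDist_comap_starAlgEquiv_le B' ρ')
  simpa using h1

/-- The colour of a space is the set of points of a finite `δ/2`-net of the `K`-ball of `E` that lie
near the image of its bounded Lip unit ball. Equal colours put these images within `δ` of each
other. -/
theorem exists_coloring_of_starAlgEquiv (hF : Permissible F) (E : Type u) [CStarAlgebra E]
    [Nontrivial E] [FiniteDimensional ℂ E] {K δ : ℝ} (hK : 0 ≤ K) (hδ : 0 < δ) :
    ∃ (ι : Type u) (_ : Finite ι) (col : QLQCMS.{u} F → ι), ∀ B B' : QLQCMS.{u} F,
      B.diam ≤ ENNReal.ofReal K → B'.diam ≤ ENNReal.ofReal K → Nonempty (B ≃⋆ₐ[ℂ] E) →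
      Nonempty (B' ≃⋆ₐ[ℂ] E) → col B = col B' → propinquity B B' ≤ ENNReal.ofReal δ := by
  classical
  have : ProperSpace E := FiniteDimensional.proper ℂ E
  obtain ⟨N, hN, hcov⟩ := Metric.totallyBounded_iff.1
    (isCompact_closedBall (0 : E) K).totallyBounded (δ / 2) (by positivity)
  have := hN.to_subtype
  -- By proof irrelevance `ρ.some` is one fixed identification of `B` with `E`, so the colour and
  -- the later comparison use the same one.
  let col : QLQCMS.{u} F → Set N := fun B =>
    {x | ∃ (ρ : Nonempty (B ≃⋆ₐ[ℂ] E)) (a : selfAdjoint B), B.lip a ≤ 1 ∧ ‖a‖ ≤ K ∧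
      dist (ρ.some (a : B)) x < δ / 2}
  have key : ∀ (B B' : QLQCMS.{u} F) (ρ : Nonempty (B ≃⋆ₐ[ℂ] E)) (ρ' : Nonempty (B' ≃⋆ₐ[ℂ] E)),
      col B = col B' → ∀ a : selfAdjoint B, B.lip a ≤ 1 → ‖a‖ ≤ K →
        ∃ b : selfAdjoint B', B'.lip b ≤ 1 ∧ ‖ρ.some (a : B) - ρ'.some (b : B')‖ ≤ δ := by
    intro B B' ρ ρ' hcol a ha haK
    have hmem : ρ.some (a : B) ∈ Metric.closedBall (0 : E) K := by
      rw [mem_closedBall_zero_iff]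
      exact (norm_saMap_le ρ.some.toStarAlgHom a).trans haK
    obtain ⟨x, hx, hax⟩ := Set.mem_iUnion₂.1 (hcov hmem)
    have h1 : (⟨x, hx⟩ : N) ∈ col B := ⟨ρ, a, ha, haK, hax⟩
    rw [hcol] at h1
    obtain ⟨_, b, hb, -, hbx⟩ := h1
    refine ⟨b, hb, ?_⟩
    rw [← dist_eq_norm]
    have := dist_triangle_right (ρ.some (a : B)) (ρ'.some (b : B')) x
    have h2 : dist (ρ.some (a : B)) x < δ / 2 := hax
    have h3 : dist (ρ'.some (b : B')) x < δ / 2 := hbx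
    linarith
  exact ⟨Set N, inferInstance, col, fun B B' hB hB' ρ ρ' hcol =>
    propinquity_le_of_unitBall_close hF ρ.some ρ'.some hK hδ hB hB' (key B B' ρ ρ' hcol)
      (key B' B ρ' ρ hcol.symm)⟩

/-- `M` needs no C*-structure: any `F`-space of this algebra type serves as the model, and if there
is none, one colour suffices vacuously. -/
theorem exists_coloring_of_algEquiv (hF : Permissible F) (M : Type) [Ring M] [Algebra ℂ M]
    {K δ : ℝ} (hK : 0 ≤ K) (hδ : 0 < δ) :
    ∃ (ι : Type u) (_ : Finite ι) (col : QLQCMS.{u} F → ι), ∀ B B' : QLQCMS.{u} F,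
      FiniteDimensional ℂ B → FiniteDimensional ℂ B' →
      B.diam ≤ ENNReal.ofReal K → B'.diam ≤ ENNReal.ofReal K → Nonempty (B ≃ₐ[ℂ] M) →
      Nonempty (B' ≃ₐ[ℂ] M) → col B = col B' → propinquity B B' ≤ ENNReal.ofReal δ := by
  by_cases hE : ∃ E : QLQCMS.{u} F, FiniteDimensional ℂ E ∧ Nonempty (E ≃ₐ[ℂ] M)
  · obtain ⟨E, hE, ⟨e⟩⟩ := hE
    obtain ⟨ι, hι, col, hcol⟩ := exists_coloring_of_starAlgEquiv hF E hK hδ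
    exact ⟨ι, hι, col, fun B B' _ _ hB hB' ⟨f⟩ ⟨f'⟩ => hcol B B' hB hB'
      (nonempty_starAlgEquiv_of_algEquiv (f.trans e.symm))
      (nonempty_starAlgEquiv_of_algEquiv (f'.trans e.symm))⟩
  · exact ⟨PUnit, inferInstance, fun _ => PUnit.unit, fun B _ hB _ _ _ f =>
      (hE ⟨B, hB, f⟩).elim⟩

/-- The finite dimensional spaces of bounded dimension and diameter can be divided into finitely
many classes of small diameter for the dual propinquity. -/
theorem exists_coloring (hF : Permissible F) (N : ℕ) {K δ : ℝ} (hK : 0 ≤ K) (hδ : 0 < δ) :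
    ∃ (ι : Type u) (_ : Finite ι) (col : QLQCMS.{u} F → ι), ∀ B B' : QLQCMS.{u} F,
      Module.rank ℂ B ≤ (N : Cardinal.{u}) → Module.rank ℂ B' ≤ (N : Cardinal.{u}) →
      B.diam ≤ ENNReal.ofReal K → B'.diam ≤ ENNReal.ofReal K → col B = col B' →
      propinquity B B' ≤ ENNReal.ofReal δ := by
  classical
  let κ := Σ n : Fin (N + 1), Fin n → Fin (N + 1)
  have hfd : ∀ B : QLQCMS.{u} F, Module.rank ℂ B ≤ (N : Cardinal.{u}) → FiniteDimensional ℂ B :=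
    fun B hB => Module.rank_lt_aleph0_iff.1 (hB.trans_lt Cardinal.natCast_lt_aleph0)
  have hkey : ∀ B : QLQCMS.{u} F, ∃ k : κ, Module.rank ℂ B ≤ (N : Cardinal.{u}) →
      Nonempty (B ≃ₐ[ℂ] ((i : Fin k.1) → Matrix (Fin (k.2 i)) (Fin (k.2 i)) ℂ)) := fun B => by
    by_cases hB : Module.rank ℂ B ≤ (N : Cardinal.{u})
    · have := hfd B hB
      obtain ⟨k, hk⟩ := exists_algEquiv_pi_matrix B (Module.finrank_le_of_rank_le hB)
      exact ⟨k, fun _ => hk⟩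
    · exact ⟨⟨0, fun _ => 0⟩, fun h => (hB h).elim⟩
  choose key hkey using hkey
  choose ι hι col hcol using fun k : κ => exists_coloring_of_algEquiv.{u} hF
    ((i : Fin k.1) → Matrix (Fin (k.2 i)) (Fin (k.2 i)) ℂ) hK hδ
  -- Storing the colours for all algebra types at once avoids a colour whose type depends on `key
  -- B`.
  refine ⟨κ × ∀ k, ι k, inferInstance, fun B => (key B, fun k => col k B),
    fun B B' hB hB' hBK hBK' h => ?_⟩
  have h1 : key B = key B' := congrArg Prod.fst h
  have h2 : col (key B) B = col (key B) B' := congrFun (congrArg Prod.snd h) (key B)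
  exact hcol (key B) B B' (hfd B hB) (hfd B' hB') hBK hBK' (hkey B hB) (h1 ▸ hkey B' hB') h2

end Coloring

/-! ### Covering numbers and total boundedness -/

section Main

variable {F : ℝ≥0 × ℝ≥0 × ℝ≥0 × ℝ≥0 → ℝ≥0} {𝒜 : Set (QLQCMS.{u} F)}

theorem exists_of_coveringNumber_le {A : QLQCMS.{u} F} {ε : ℝ} {n : ℕ}
    (h : coveringNumber A ε ≤ n) : ∃ B : QLQCMS.{u} F,
      Module.rank ℂ B ≤ (n : Cardinal.{u}) ∧ propinquity A B ≤ ENNReal.ofReal ε := by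
  -- Passing to the strict bound `n + 1` yields an admissible dimension below it, hence at most `n`.
  have h1 : coveringNumber A ε < ((n + 1 : ℕ) : ℕ∞) := h.trans_lt (by exact_mod_cast n.lt_succ_self)
  simp only [coveringNumber, iInf_lt_iff] at h1
  obtain ⟨m, ⟨B, hB, hAB⟩, hm⟩ := h1
  refine ⟨B, hB.trans ?_, hAB⟩
  exact_mod_cast Nat.lt_succ_iff.1 (by exact_mod_cast hm)

theorem propinquityTotallyBounded_of_coveringNumber_le (hF : Permissible F)
    {f : Set.Ioi (0 : ℝ) → ℕ} {K : ℝ} (hK : 0 ≤ K)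
    (h : ∀ A ∈ 𝒜, A.diam ≤ ENNReal.ofReal K ∧
      ∀ ε : Set.Ioi (0 : ℝ), coveringNumber A (ε : ℝ) ≤ (f ε : ℕ∞)) :
    PropinquityTotallyBounded 𝒜 := by
  intro ε hε
  obtain ⟨e, he, heε⟩ := exists_pos_ofReal_le hε
  have he4 : 0 < e / 4 := by positivity
  choose! B hBrank hAB using fun (A : QLQCMS.{u} F) (hA : A ∈ 𝒜) =>
    exists_of_coveringNumber_le ((h A hA).2 ⟨e / 4, he4⟩)
  have hBdiam : ∀ A ∈ 𝒜, (B A).diam ≤ ENNReal.ofReal (K + 2 * e) := fun A hA => by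
    refine diam_le_of_propinquity_lt hK he.le (h A hA).1 ?_
    rw [propinquity_comm]
    exact (hAB A hA).trans_lt (ENNReal.ofReal_lt_ofReal_iff he |>.2 (by simp; linarith))
  obtain ⟨ι, hι, col, hcol⟩ := exists_coloring.{u} hF (f ⟨e / 4, he4⟩)
    (by positivity : 0 ≤ K + 2 * e) he4
  -- Spaces of `𝒜` are coloured through their approximants, and one space of `𝒜` is kept per colour
  -- that occurs, so the net lies in `𝒜`. Passing from `A` through both approximants costs three
  -- times `e / 4`.
  let c : 𝒜 → ι := fun A => col (B A)
  let rep : Set.range c → 𝒜 := fun i => i.2.choose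
  have hrep : ∀ i, c (rep i) = i := fun i => i.2.choose_spec
  refine ⟨Set.range fun i => (rep i : QLQCMS.{u} F), ?_, Set.finite_range _, fun A hA => ?_⟩
  · rintro _ ⟨i, rfl⟩
    exact (rep i).2
  · set A' := rep ⟨c ⟨A, hA⟩, ⟨A, hA⟩, rfl⟩ with hA'
    refine ⟨A', ⟨_, rfl⟩, lt_of_le_of_lt ?_ heε⟩
    have hc : col (B A) = col (B A') := (hrep ⟨c ⟨A, hA⟩, ⟨A, hA⟩, rfl⟩).symm
    have h1 := hcol _ _ (hBrank A hA) (hBrank A' A'.2) (hBdiam A hA) (hBdiam A' A'.2) hc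
    have h2 := hAB A' A'.2
    rw [propinquity_comm] at h2
    refine (propinquity_triangle hF A (B A) A').trans ((add_le_add (hAB A hA)
      ((propinquity_triangle hF _ (B A') _).trans (add_le_add h1 h2))).trans ?_)
    change ENNReal.ofReal (e / 4) + (ENNReal.ofReal (e / 4) + ENNReal.ofReal (e / 4)) ≤ _
    rw [← ENNReal.ofReal_add he4.le he4.le, ← ENNReal.ofReal_add he4.le (by positivity)]
    exact ENNReal.ofReal_le_ofReal (by linarith)

/-- A finite 1-net suffices: each of its points has finite diameter, and its neighbours exceed that
by at most 2. -/
theorem exists_diam_le_of_propinquityTotallyBounded (h : PropinquityTotallyBounded 𝒜) :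
    ∃ K : ℝ, 0 < K ∧ ∀ A ∈ 𝒜, A.diam ≤ ENNReal.ofReal K := by
  obtain ⟨T, -, hT, hA⟩ := h 1 one_pos
  choose R hR0 hR using fun A : QLQCMS.{u} F => A.exists_diam_le
  obtain ⟨M, hM⟩ := (hT.image R).bddAbove
  refine ⟨max M 0 + 2 * 1, by positivity, fun A hA' => ?_⟩
  obtain ⟨B, hB, hAB⟩ := hA A hA'
  refine diam_le_of_propinquity_lt (le_max_right _ _) zero_le_one ((hR B).trans
    (ENNReal.ofReal_le_ofReal ?_)) (by rwa [ENNReal.ofReal_one])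
  exact (hM ⟨B, hB, rfl⟩).trans (le_max_left _ _)

/-- Only the finitely many points of an `ε/2`-net need `ε/2`-approximants; the largest of their
dimensions serves for all of `𝒜`. -/
theorem exists_coveringNumber_le_of_propinquityTotallyBounded (hF : Permissible F)
    (h𝒜 : 𝒜 ⊆ propinquityClosure (finiteDimensional.{u} F)) (h : PropinquityTotallyBounded 𝒜)
    {ε : ℝ} (hε : 0 < ε) : ∃ n : ℕ, ∀ A ∈ 𝒜, coveringNumber A ε ≤ (n : ℕ∞) := by
  have hε2 : 0 < ENNReal.ofReal (ε / 2) := ENNReal.ofReal_pos.2 (by positivity)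
  obtain ⟨T, hT𝒜, hT, hA⟩ := h _ hε2
  choose! B hB hAB using fun (A : QLQCMS.{u} F) (hA : A ∈ 𝒜) => h𝒜 hA _ hε2
  obtain ⟨n, hn⟩ := (hT.image fun A => Module.finrank ℂ (B A)).bddAbove
  refine ⟨n, fun A hA' => ?_⟩
  obtain ⟨A', hA', hAA'⟩ := hA A hA'
  have : FiniteDimensional ℂ (B A') := hB A' (hT𝒜 hA')
  refine iInf₂_le n ⟨B A', ?_, ?_⟩
  · rw [← Module.finrank_eq_rank]
    exact_mod_cast hn ⟨A', hA', rfl⟩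
  · refine (propinquity_triangle hF A A' _).trans
      ((add_le_add hAA'.le (hAB A' (hT𝒜 hA')).le).trans ?_)
    rw [← ENNReal.ofReal_add (by positivity) (by positivity), add_halves]

end Main

end QuantumMetric

theorem mainTheorem1 (F : ℝ≥0 × ℝ≥0 × ℝ≥0 × ℝ≥0 → ℝ≥0)
    (hF : QuantumMetric.StronglyPermissible F)
    (𝒜 : Set (QuantumMetric.QLQCMS.{u} F))
    (h𝒜 : 𝒜 ⊆ QuantumMetric.propinquityClosure (QuantumMetric.finiteDimensional.{u} F)) :
    QuantumMetric.PropinquityTotallyBounded 𝒜 ↔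
      ∃ (f : Set.Ioi (0 : ℝ) → ℕ) (K : ℝ), 0 < K ∧
        ∀ A ∈ 𝒜, A.diam ≤ ENNReal.ofReal K ∧
          ∀ ε : Set.Ioi (0 : ℝ), QuantumMetric.coveringNumber A (ε : ℝ) ≤ (f ε : ℕ∞) := by
  constructor
  · intro h
    obtain ⟨K, hK, hdiam⟩ := QuantumMetric.exists_diam_le_of_propinquityTotallyBounded h
    choose f hf using fun ε : Set.Ioi (0 : ℝ) =>
      QuantumMetric.exists_coveringNumber_le_of_propinquityTotallyBounded hF.toPermissible h𝒜 h ε.2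
    exact ⟨f, K, hK, fun A hA => ⟨hdiam A hA, fun ε => hf ε A hA⟩⟩
  · rintro ⟨f, K, hK, h⟩
    exact QuantumMetric.propinquityTotallyBounded_of_coveringNumber_le hF.toPermissible hK.le h
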